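/- Let $n\ge 1$ be an odd integer and let $h:\mathbb{R}^n\to\mathbb{R}$ be a smooth, compactly supported function with $0\notin\operatorname{supp}h$. Let $\omega_{n-1}$ be the surface area of the unit sphere $S^{n-1}\subset\mathbb{R}^n$ and $$(\mathcal{M}h)(c,t)=\frac1{\omega_{n-1}}\int_{S^{n-1}}h(c+t\theta)\,d\theta$$ the mean value of $h$ over the sphere with center $c\in\mathbb{R}^n$ and radius $t$ (for $n=1$, $S^0=\{\pm1\}$ with counting measure). For $y\neq 0$ write $\rho=|y|$, and let $\partial_\rho=|y|^{-1}\,y\cdot\nabla$ be the radial derivative. Then the function $\rho^{n-1}(\mathcal{M}h)(y,|y|)$ is smooth along every open ray from the origin, all integrals below converge absolutely, and the following hold. (1) Isometry: $$\int_{\mathbb{R}^n}|x|^{2n-4}\,|h(x)|^2\,dx=\frac{2\pi}{\Gamma(n/2)^2}\int_{\mathbb{R}^n}\left|(\rho^2\partial_\rho)^{(n-1)/2}\bigl(\rho^{n-1}(\mathcal{M}h)(y,|y|)\bigr)\right|^2|y|^{-n-1}\,dy .$$ (2) Inversion formula: for every $x\in\mathbb{R}^n$, $x\neq0$, $$h(x)=\frac{(-1)^{(n-1)/2}\,\omega_{n-1}}{2\,\pi^{n-1}}\,|x|^{3-2n}\int_{2y\cdot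 x=|x|^2}|y|^{-n}\,(\rho^2\partial_\rho)^{n-1}\bigl(\rho^{n-1}(\mathcal{M}h)(y,|y|)\bigr)\,dS_y ,$$ where $dS_y$ is the surface measure on the hyperplane $\{y: 2y\cdot x=|x|^2\}$, i.e. the integral is over all spheres through $x$ and the origin. (3) In particular, the means over spheres through the origin determine $h$: if $h_1:\mathbb{R}^n\to\mathbb{R}$ is another smooth compactly supported function with $0\notin\operatorname{supp}h_1$ and $(\mathcal{M}h_1)(y,|y|)=(\mathcal{M}h)(y,|y|)$ for all $y\in\mathbb{R}^n$, then $h_1=h$. -/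

import Mathlib

open MeasureTheory

noncomputable section

namespace OriginSpheres

/-- The surface area of the unit sphere in `ℝⁿ` (the number usually written `ω_{n-1}`). -/
def sphereArea (n : ℕ) : ℝ :=
  (volume : Measure (EuclideanSpace ℝ (Fin n))).toSphere.real Set.univ

/-- The mean value of `h` over the sphere with center `c` and radius `t`, that is
`(1 / ω_{n-1}) ∫_{|θ| = 1} h (c + t θ) dθ`. -/
def sphericalMean {n : ℕ} (h : EuclideanSpace ℝ (Fin n) → ℝ)
    (c : EuclideanSpace ℝ (Fin n)) (t : ℝ) : ℝ :=
  (sphereArea n)⁻¹ *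
    ∫ θ : Metric.sphere (0 : EuclideanSpace ℝ (Fin n)) 1,
      h (c + t • (θ : EuclideanSpace ℝ (Fin n)))
        ∂(volume : Measure (EuclideanSpace ℝ (Fin n))).toSphere

/-- The radial derivative `∂_ρ`: the derivative of `g` at `y` in the direction `y / |y|`. -/
def radialDeriv {n : ℕ} (g : EuclideanSpace ℝ (Fin n) → ℝ)
    (y : EuclideanSpace ℝ (Fin n)) : ℝ :=
  lineDeriv ℝ g y (‖y‖⁻¹ • y)

/-- The operator `ρ² ∂_ρ`, where `ρ = |y|`. -/
def rhoSqRadialDeriv {n : ℕ} (g : EuclideanSpace ℝ (Fin n) → ℝ)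
    (y : EuclideanSpace ℝ (Fin n)) : ℝ :=
  ‖y‖ ^ 2 * radialDeriv g y

/-- The function `y ↦ ρ^(n-1) (M h)(y, |y|)` with `ρ = |y|`; here `(M h)(y, |y|)` is the mean of `h`
over the sphere through the origin with center `y`. -/
def weightedOriginMean {n : ℕ} (h : EuclideanSpace ℝ (Fin n) → ℝ)
    (y : EuclideanSpace ℝ (Fin n)) : ℝ :=
  ‖y‖ ^ (n - 1) * sphericalMean h y ‖y‖

/-- The function `(ρ² ∂_ρ)^k (ρ^(n-1) (M h)(y, |y|))`. -/
def meanData {n : ℕ} (k : ℕ) (h : EuclideanSpace ℝ (Fin n) → ℝ) :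
    EuclideanSpace ℝ (Fin n) → ℝ :=
  rhoSqRadialDeriv^[k] (weightedOriginMean h)

/-- Smooth compactly supported functions on `ℝⁿ` whose support does not contain the origin. -/
def IsTestAwayFromZero {n : ℕ} (h : EuclideanSpace ℝ (Fin n) → ℝ) : Prop :=
  ContDiff ℝ (⊤ : ℕ∞) h ∧ HasCompactSupport h ∧ (0 : EuclideanSpace ℝ (Fin n)) ∉ tsupport h

/-- The hyperplane `2 y · x = |x|²` (for `x ≠ 0`), the set of centers of the spheres through `x`
and the origin. -/
def bisector {n : ℕ} (x : EuclideanSpace ℝ (Fin n)) : Set (EuclideanSpace ℝ (Fin n)) :=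
  {y | 2 * inner ℝ y x = ‖x‖ ^ 2}

end OriginSpheres

end

noncomputable section

namespace OriginSpheres

/-! ### Polar coordinates and the substitution `s = 1/(2r)`. -/

section PolarCoordinates

open Set Metric Module

variable {V : Type*} [NormedAddCommGroup V] [InnerProductSpace ℝ V] [FiniteDimensional ℝ V]
  [MeasurableSpace V] [BorelSpace V]
variable {F : Type*} [NormedAddCommGroup F] [NormedSpace ℝ F]

/-! Inversion `x ↦ x/|x|²` carries the sphere through the origin with center `ρθ` to the hyperplane
`ξ·θ = 1/(2ρ)`. Hence `ρ^(n-1) (M h)(ρθ, ρ)` is `1/ω_{n-1}` times the Radon transform of `g =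
invTransform h` at `(θ, s)`, `s = 1/(2ρ)`, and `ρ²∂_ρ` becomes `-½ ∂_s`. Since `h` has compact
support and vanishes near `0`, so does `g`.

Hyperplane integrals are never formed. With `γ` the inverse Fourier transform of `g`, the Fourier
slice theorem makes the Radon transform the one-dimensional Fourier transform of `σ ↦ γ(σθ)`; this
is `rayFourier`, smooth in `s` with derivatives given by powers of `-2πiσ`. The link with the means
is proved against test functions in `s` (`integral_comp_add_norm_smul`, `integral_rayFourier_mul`),
then pointwise by continuity (`weightedOriginMean_eq_rayFourier`); `meanData_eq` follows by
induction.

The isometry is Plancherel on each line `ℝθ`, polar coordinates, and Plancherel for `γ`: for odd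
`n`, the `(n-1)/2` derivatives supply exactly the polar weight `σ^(n-1)`. The inversion formula is
`g(ξ) = ∫ γ(η) e^{-2πi η·ξ} dη` at `ξ = x/|x|²`, written with `η = t(e + w)`, `e = x/|x|`, `w ⊥ e`.
The `t`-integral is the data at the center `(|x|/2)(e + w)`, and these centers fill the hyperplane
in the formula (`integral_cone`, `integral_meanData_cone`). Injectivity follows from the inversion
formula. -/

theorem integral_volumeIoiPow (k : ℕ) (f : ℝ → F) :
    ∫ x : Ioi (0 : ℝ), f x ∂(Measure.volumeIoiPow k) = ∫ r in Ioi (0 : ℝ), r ^ k • f r := by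
  simp only [Measure.volumeIoiPow, ENNReal.ofReal]
  rw [integral_withDensity_eq_integral_smul,
    integral_subtype_comap measurableSet_Ioi fun a ↦ Real.toNNReal (a ^ k) • f a,
    setIntegral_congr_fun measurableSet_Ioi fun x hx ↦ ?_]
  · rw [NNReal.smul_def, Real.coe_toNNReal _ (pow_nonneg hx.out.le _)]
  · exact (measurable_subtype_coe.pow_const _).real_toNNReal

/-- Integration in polar coordinates, as an integral over `S × (0, ∞)`. -/
theorem integral_polar_prod [Nontrivial V] (f : V → F) :
    ∫ x, f x = ∫ p : sphere (0 : V) 1 × Ioi (0 : ℝ), f (p.2.1 • p.1.1)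
      ∂((volume : Measure V).toSphere.prod (Measure.volumeIoiPow (finrank ℝ V - 1))) := by
  have h := (volume : Measure V).measurePreserving_homeomorphUnitSphereProd.integral_comp
      (Homeomorph.measurableEmbedding _)
      (fun p : sphere (0 : V) 1 × Ioi (0 : ℝ) ↦ f (p.2.1 • p.1.1))
  rw [← h]
  conv_lhs => rw [← restrict_compl_singleton (μ := (volume : Measure V)) 0]
  rw [← integral_subtype_comap (measurableSet_singleton (0 : V)).compl f]
  refine integral_congr_ae (.of_forall fun x ↦ ?_)
  have : ‖x.1‖ ≠ 0 := norm_ne_zero_iff.2 x.2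
  simp [smul_smul, this]

theorem integrable_polar_prod {F : Type*} [NormedAddCommGroup F] [Nontrivial V] {f : V → F}
    (hf : Integrable f) :
    Integrable (fun p : sphere (0 : V) 1 × Ioi (0 : ℝ) ↦ f (p.2.1 • p.1.1))
      ((volume : Measure V).toSphere.prod (Measure.volumeIoiPow (finrank ℝ V - 1))) := by
  rw [← (volume : Measure V).measurePreserving_homeomorphUnitSphereProd.integrable_comp_emb
      (Homeomorph.measurableEmbedding _)]
  rw [← restrict_compl_singleton (μ := (volume : Measure V)) 0, ← IntegrableOn,
    integrableOn_iff_comap_subtypeVal (by measurability)] at hf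
  refine hf.congr (.of_forall fun x ↦ ?_)
  have : ‖x.1‖ ≠ 0 := norm_ne_zero_iff.2 x.2
  simp [smul_smul, this]

theorem integral_polar_sphere [Nontrivial V] {f : V → F} (hf : Integrable f) :
    ∫ x, f x = ∫ θ : sphere (0 : V) 1, (∫ r in Ioi (0 : ℝ), r ^ (finrank ℝ V - 1) • f (r • θ.1))
      ∂(volume : Measure V).toSphere := by
  rw [integral_polar_prod, integral_prod _ (integrable_polar_prod hf)]
  refine integral_congr_ae (.of_forall fun θ ↦ ?_)
  exact integral_volumeIoiPow _ fun r ↦ f (r • θ.1)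

theorem integral_polar_radius [Nontrivial V] {f : V → F} (hf : Integrable f) :
    ∫ x, f x = ∫ r in Ioi (0 : ℝ), r ^ (finrank ℝ V - 1) •
      ∫ θ : sphere (0 : V) 1, f (r • θ.1) ∂(volume : Measure V).toSphere := by
  rw [integral_polar_prod, integral_prod_symm _ (integrable_polar_prod hf)]
  exact integral_volumeIoiPow _ fun r ↦ ∫ θ : sphere (0 : V) 1, f (r • θ.1)
      ∂(volume : Measure V).toSphere

/-- Passes between the radius `r` of a sphere through the origin and the distance `s = 1/(2r)` of
its image hyperplane from the origin. -/
theorem integral_comp_half_inv (f : ℝ → F) :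
    ∫ s in Ioi (0 : ℝ), f s = ∫ r in Ioi (0 : ℝ), (2 * r ^ 2)⁻¹ • f ((2 * r)⁻¹) := by
  have himg : (fun r : ℝ ↦ (2 * r)⁻¹) '' Ioi 0 = Ioi 0 := by
    ext s
    constructor
    · rintro ⟨r, hr, rfl⟩
      exact inv_pos.2 (mul_pos two_pos (mem_Ioi.1 hr))
    · intro hs
      have hs : 0 < s := hs
      exact ⟨(2 * s)⁻¹, inv_pos.2 (mul_pos two_pos hs), by field_simp⟩
  have hinj : InjOn (fun r : ℝ ↦ (2 * r)⁻¹) (Ioi 0) := by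
    intro a _ b _ hab
    have := inv_injective hab
    linarith
  have hder : ∀ r ∈ Ioi (0 : ℝ),
      HasDerivWithinAt (fun r : ℝ ↦ (2 * r)⁻¹) (-(2 * r ^ 2)⁻¹) (Ioi 0) r := by
    intro r hr
    have hr : 0 < r := hr
    have h := ((hasDerivAt_id r).const_mul 2).inv (by simpa using hr.ne')
    refine (h.congr_deriv ?_).hasDerivWithinAt
    simp only [id]
    field_simp
  conv_lhs => rw [← himg]
  rw [integral_image_eq_integral_abs_deriv_smul measurableSet_Ioi hder hinj]
  refine setIntegral_congr_fun measurableSet_Ioi fun r hr ↦ ?_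
  have hr : 0 < r := hr
  simp only [abs_neg, abs_of_pos (inv_pos.2 (show 0 < 2 * r ^ 2 by positivity))]

end PolarCoordinates

/-! ### Change of variables from spheres through the origin to hyperplanes. -/

section CenteredInversion

open Set Metric Module

variable {V : Type*} [NormedAddCommGroup V] [InnerProductSpace ℝ V] [FiniteDimensional ℝ V]
  [MeasurableSpace V] [BorelSpace V]
variable {F : Type*} [NormedAddCommGroup F] [NormedSpace ℝ F]

/-- The map `ξ ↦ ξ/|ξ|² - θ/(2ξ·θ)`, the inverse of `z ↦ (z + |z|θ)/|z + |z|θ|²`. -/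
def centeredInversion (θ ξ : V) : V :=
  (‖ξ‖ ^ 2)⁻¹ • ξ - (2 * inner ℝ ξ θ)⁻¹ • θ

/-- The derivative of `centeredInversion θ` at `ξ`. -/
def centeredInversionDeriv (θ ξ : V) : V →L[ℝ] V :=
  (‖ξ‖ ^ 2)⁻¹ • ContinuousLinearMap.id ℝ V
    - (2 * ((‖ξ‖ ^ 2)⁻¹) ^ 2) • (innerSL ℝ ξ).smulRight ξ
    + (2 * (inner ℝ ξ θ) ^ 2)⁻¹ • (innerSL ℝ θ).smulRight θ

omit [FiniteDimensional ℝ V] [MeasurableSpace V] [BorelSpace V] in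
theorem hasFDerivAt_centeredInversion {θ ξ : V} (hξ : 0 < inner ℝ ξ θ) :
    HasFDerivAt (centeredInversion θ) (centeredInversionDeriv θ ξ) ξ := by
  have h0 : ξ ≠ 0 := by rintro rfl; simp at hξ
  have hn : ‖ξ‖ ≠ 0 := norm_ne_zero_iff.2 h0
  have A := hasFDerivAt_id (𝕜 := ℝ) ξ
  have B := (hasDerivAt_inv (pow_ne_zero 2 hn)).comp_hasFDerivAt ξ A.norm_sq
  have C := (A.inner ℝ (hasFDerivAt_const θ ξ)).const_mul 2
  have D := (hasDerivAt_inv (show 2 * inner ℝ ξ θ ≠ 0 by positivity)).comp_hasFDerivAt ξ C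
  have := (B.smul A).sub (D.smul (hasFDerivAt_const θ ξ))
  refine this.congr_fderiv ?_
  ext v
  simp [centeredInversionDeriv, fderivInnerCLM_apply, real_inner_comm]
  have hb : inner ℝ θ ξ ≠ 0 := by rw [real_inner_comm]; exact hξ.ne'
  match_scalars <;> field_simp

omit [MeasurableSpace V] [BorelSpace V] in
theorem abs_det_centeredInversionDeriv {θ ξ : V} (hθ : ‖θ‖ = 1) (hξ : 0 < inner ℝ ξ θ) :
    |(centeredInversionDeriv θ ξ).det| =
      ((‖ξ‖ ^ 2)⁻¹) ^ finrank ℝ V * (‖ξ‖ ^ 2 * (2 * (inner ℝ ξ θ) ^ 2)⁻¹) := by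
  have h0 : ξ ≠ 0 := by rintro rfl; simp at hξ
  have hn : ‖ξ‖ ≠ 0 := norm_ne_zero_iff.2 h0
  have hb : inner ℝ ξ θ ≠ 0 := hξ.ne'
  set c := (‖ξ‖ ^ 2)⁻¹ with hc
  set b := inner ℝ ξ θ with hb'
  have hc0 : c * ‖ξ‖ ^ 2 = 1 := by rw [hc]; field_simp
  -- Factor as `c` times the reflection `1 - 2c ξξᵀ`, of determinant `-1`, times a rank-one
  -- perturbation of the identity, of determinant `|ξ|²/(2b²)`.
  have hL : ((centeredInversionDeriv θ ξ : V →L[ℝ] V) : V →ₗ[ℝ] V) =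
      c • (LinearMap.transvection ((-2 * c) • innerₗ V ξ) ξ ∘ₗ
        LinearMap.transvection (innerₗ V θ) ((‖ξ‖ ^ 2 * (2 * b ^ 2)⁻¹) • (θ - (2 * c * b) • ξ))) := by
    ext v
    simp only [centeredInversionDeriv, LinearMap.transvection.apply, LinearMap.smul_apply,
      LinearMap.comp_apply, innerₗ_apply_apply, ContinuousLinearMap.coe_coe,
      add_apply, sub_apply,
      smul_apply, ContinuousLinearMap.smulRight_apply, innerSL_apply_apply,
      ContinuousLinearMap.id_apply, ← hb', ← hc, inner_add_right, inner_sub_right, inner_smul_right,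
      real_inner_self_eq_norm_sq, smul_eq_mul]
    match_scalars
    · ring
    · field_simp
      linear_combination (-2 * c ^ 2 * inner ℝ θ v * ‖ξ‖ ^ 2) * hc0
    · field_simp
      linear_combination (-inner ℝ θ v) * hc0
  have hdet : (centeredInversionDeriv θ ξ).det = -(c ^ finrank ℝ V * (‖ξ‖ ^ 2 * (2 * b ^ 2)⁻¹)) := by
    rw [ContinuousLinearMap.det, hL, LinearMap.det_smul, LinearMap.det_comp,
      LinearMap.transvection.det, LinearMap.transvection.det]
    simp only [LinearMap.smul_apply, innerₗ_apply_apply, inner_sub_right, inner_smul_right,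
      real_inner_self_eq_norm_sq, hθ, smul_eq_mul, real_inner_comm ξ θ, ← hb']
    rw [hc]
    field_simp
    ring
  rw [hdet, abs_neg, abs_of_pos]
  positivity

omit [FiniteDimensional ℝ V] [MeasurableSpace V] [BorelSpace V] in
theorem norm_centeredInversion {θ ξ : V} (hθ : ‖θ‖ = 1) (hξ : 0 < inner ℝ ξ θ) :
    ‖centeredInversion θ ξ‖ = (2 * inner ℝ ξ θ)⁻¹ := by
  have h0 : ξ ≠ 0 := by rintro rfl; simp at hξ
  have hn : ‖ξ‖ ≠ 0 := norm_ne_zero_iff.2 h0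
  rw [← sq_eq_sq₀ (norm_nonneg _) (by positivity), centeredInversion, norm_sub_sq_real, norm_smul,
    norm_smul, inner_smul_left, inner_smul_right, hθ]
  simp only [norm_inv, norm_pow, norm_mul, Real.norm_eq_abs, abs_of_pos hξ, abs_norm]
  simp
  field_simp
  ring

omit [FiniteDimensional ℝ V] [MeasurableSpace V] [BorelSpace V] in
theorem centeredInversion_add {θ ξ : V} (hθ : ‖θ‖ = 1) (hξ : 0 < inner ℝ ξ θ) :
    centeredInversion θ ξ + ‖centeredInversion θ ξ‖ • θ = (‖ξ‖ ^ 2)⁻¹ • ξ := by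
  rw [norm_centeredInversion hθ hξ, centeredInversion, sub_add_cancel]

omit [FiniteDimensional ℝ V] [MeasurableSpace V] [BorelSpace V] in
theorem inversion_inversion_zero (x : V) :
    (‖(‖x‖ ^ 2)⁻¹ • x‖ ^ 2)⁻¹ • ((‖x‖ ^ 2)⁻¹ • x) = x := by
  rcases eq_or_ne x 0 with rfl | hx
  · simp
  have hn : ‖x‖ ≠ 0 := norm_ne_zero_iff.2 hx
  rw [norm_smul, smul_smul]
  simp only [norm_inv, norm_pow, norm_norm]
  convert one_smul ℝ x
  field_simp

omit [FiniteDimensional ℝ V] [MeasurableSpace V] [BorelSpace V] in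
theorem injOn_centeredInversion {θ : V} (hθ : ‖θ‖ = 1) :
    InjOn (centeredInversion θ) {ξ | 0 < inner ℝ ξ θ} := by
  intro a ha b hb hab
  have h := centeredInversion_add hθ ha
  rw [hab, centeredInversion_add hθ hb] at h
  rw [← inversion_inversion_zero a, ← inversion_inversion_zero b, h]

omit [FiniteDimensional ℝ V] [MeasurableSpace V] [BorelSpace V] in
-- The point `x = z + |z|θ` lies on the sphere through the origin with center `|z|θ`, so `|x|² =
-- 2|z|⟨x, θ⟩`. This forces `⟨x, θ⟩ > 0` and recovers `|z|` from `x`; the preimage is the inversion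
-- of `x`.
theorem mem_image_centeredInversion {θ z : V} (hθ : ‖θ‖ = 1) (hz : z + ‖z‖ • θ ≠ 0) :
    z ∈ centeredInversion θ '' {ξ | 0 < inner ℝ ξ θ} := by
  set x := z + ‖z‖ • θ with hx
  have hn : 0 < ‖x‖ := norm_pos_iff.2 hz
  have hxθ : inner ℝ x θ = inner ℝ z θ + ‖z‖ := by
    rw [hx, inner_add_left, inner_smul_left, real_inner_self_eq_norm_sq, hθ]
    simp
  have hsq : ‖x‖ ^ 2 = 2 * ‖z‖ * inner ℝ x θ := by
    rw [hxθ, hx, norm_add_sq_real, norm_smul, inner_smul_right, hθ]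
    simp
    ring
  have hz0 : z ≠ 0 := by
    rintro rfl
    simp at hx
    exact hz hx
  have hz1 : 0 < ‖z‖ := norm_pos_iff.2 hz0
  have hpos : 0 < inner ℝ x θ := by
    have : 0 < 2 * ‖z‖ * inner ℝ x θ := hsq ▸ by positivity
    exact pos_of_mul_pos_right this (by positivity)
  refine ⟨(‖x‖ ^ 2)⁻¹ • x, ?_, ?_⟩
  · simp only [mem_ofPred_eq, inner_smul_left]
    exact mul_pos (by simp; positivity) hpos
  · rw [centeredInversion, inversion_inversion_zero, inner_smul_left, hsq]
    have : (2 * ((starRingEnd ℝ) (2 * ‖z‖ * inner ℝ x θ)⁻¹ * inner ℝ x θ))⁻¹ = ‖z‖ := by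
      simp
      field_simp
    rw [this, hx, add_sub_cancel_right]

/-- Weak form of the sphere–hyperplane correspondence: in polar coordinates the left side pairs the
spherical integrals with `φ` at `s = 1/(2|z|)`, while the right side pairs the Radon transform of
`invTransform h` with `φ`. -/
theorem integral_comp_add_norm_smul {θ : V} (hθ : ‖θ‖ = 1) {h : V → ℝ} (h0 : h 0 = 0)
    (φ : ℝ → ℝ) :
    ∫ z, ((2 * ‖z‖ ^ 2)⁻¹ * φ ((2 * ‖z‖)⁻¹)) * h (z + ‖z‖ • θ) =
      ∫ ξ in {ξ | 0 < inner ℝ ξ θ},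
        (((‖ξ‖ ^ 2)⁻¹) ^ (finrank ℝ V - 1) * h ((‖ξ‖ ^ 2)⁻¹ • ξ)) * φ (inner ℝ ξ θ) := by
  have hmeas : MeasurableSet {ξ : V | 0 < inner ℝ ξ θ} :=
    (isOpen_lt continuous_const (by fun_prop)).measurableSet
  have hθ0 : θ ≠ 0 := by rintro rfl; simp at hθ
  have : Nontrivial V := ⟨θ, 0, hθ0⟩
  have hd : 0 < finrank ℝ V := finrank_pos
  rw [← setIntegral_eq_integral_of_forall_compl_eq_zero
      (s := centeredInversion θ '' {ξ | 0 < inner ℝ ξ θ}),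
    integral_image_eq_integral_abs_det_fderiv_smul volume hmeas
      (fun ξ hξ ↦ (hasFDerivAt_centeredInversion hξ).hasFDerivWithinAt)
      (injOn_centeredInversion hθ)]
  · refine setIntegral_congr_fun hmeas fun ξ hξ ↦ ?_
    have hξ' : 0 < inner ℝ ξ θ := hξ
    have hξ0 : ξ ≠ 0 := by rintro rfl; simp at hξ'
    have hn : ‖ξ‖ ≠ 0 := norm_ne_zero_iff.2 hξ0
    simp only [abs_det_centeredInversionDeriv hθ hξ', centeredInversion_add hθ hξ', smul_eq_mul]
    rw [norm_centeredInversion hθ hξ']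
    obtain ⟨d, hd'⟩ := Nat.exists_eq_succ_of_ne_zero hd.ne'
    have e : (2 * (2 * inner ℝ ξ θ)⁻¹)⁻¹ = inner ℝ ξ θ := by field_simp
    have e2 : (2 * (2 * inner ℝ ξ θ)⁻¹ ^ 2)⁻¹ = 2 * inner ℝ ξ θ ^ 2 := by field_simp
    -- The weight `(2|z|²)⁻¹ = 2⟨ξ, θ⟩²` cancels against the Jacobian, leaving `|ξ|^(-2(d-1))`.
    rw [hd', e, e2]
    simp only [Nat.succ_eq_add_one, Nat.add_sub_cancel, pow_succ (‖ξ‖ ^ 2)⁻¹ d]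
    field_simp
  · intro z hz
    have : z + ‖z‖ • θ = 0 := by
      by_contra hne
      exact hz (mem_image_centeredInversion hθ hne)
    rw [this, h0, mul_zero]

end CenteredInversion

/-! ### One-dimensional Fourier transforms along lines through the origin. -/

section RayFourier

open Set Metric Module Complex FourierTransform SchwartzMap
open scoped ContDiff ComplexConjugate

variable {V : Type*} [NormedAddCommGroup V] [InnerProductSpace ℝ V] [FiniteDimensional ℝ V]
  [MeasurableSpace V] [BorelSpace V]

/-- The one-dimensional Fourier transform of `σ ↦ (-2πiσ)^k γ(σθ)`, evaluated at `s`. If `γ` is the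
inverse Fourier transform of `g`, this is the `k`-th derivative in `s` of the Radon transform
of `g`. -/
def rayFourier (γ : V → ℂ) (k : ℕ) (θ : V) (s : ℝ) : ℂ :=
  𝓕 (fun σ : ℝ ↦ (-2 * Real.pi * I * σ) ^ k * γ (σ • θ)) s

omit [FiniteDimensional ℝ V] [MeasurableSpace V] [BorelSpace V] in
theorem exists_schwartzMap_ray (γ : 𝓢(V, ℂ)) (k : ℕ) {θ : V} (hθ : ‖θ‖ = 1) :
    ∃ f : 𝓢(ℝ, ℂ), (f : ℝ → ℂ) = fun σ : ℝ ↦ (-2 * Real.pi * I * σ) ^ k * γ (σ • θ) := by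
  have hgrowth : (fun σ : ℝ ↦ σ • θ).HasTemperateGrowth := by fun_prop
  have hanti : AntilipschitzWith 1 (fun σ : ℝ ↦ σ • θ) := by
    refine AntilipschitzWith.of_le_mul_dist fun a b ↦ ?_
    rw [dist_eq_norm, dist_eq_norm, ← sub_smul, norm_smul, hθ]
    simp
  have hpoly : (fun σ : ℝ ↦ (-2 * Real.pi * I * σ) ^ k).HasTemperateGrowth := by
    have : (fun σ : ℝ ↦ (σ : ℂ)).HasTemperateGrowth := Complex.ofRealCLM.hasTemperateGrowth
    fun_prop
  refine ⟨smulLeftCLM ℂ (fun σ : ℝ ↦ (-2 * Real.pi * I * σ) ^ k)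
    (compCLMOfAntilipschitz ℂ hgrowth hanti γ), ?_⟩
  ext σ
  rw [smulLeftCLM_apply_apply hpoly]
  simp

omit [FiniteDimensional ℝ V] [MeasurableSpace V] [BorelSpace V] in
theorem contDiff_rayFourier (γ : 𝓢(V, ℂ)) (k : ℕ) {θ : V} (hθ : ‖θ‖ = 1) :
    ContDiff ℝ ∞ (rayFourier γ k θ) := by
  obtain ⟨f, hf⟩ := exists_schwartzMap_ray γ k hθ
  have := (𝓕 f).smooth ⊤
  rwa [fourier_coe, hf] at this

omit [FiniteDimensional ℝ V] [MeasurableSpace V] [BorelSpace V] in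
theorem hasDerivAt_rayFourier (γ : 𝓢(V, ℂ)) (k : ℕ) {θ : V} (hθ : ‖θ‖ = 1) (s : ℝ) :
    HasDerivAt (rayFourier γ k θ) (rayFourier γ (k + 1) θ s) s := by
  obtain ⟨f, hf⟩ := exists_schwartzMap_ray γ k hθ
  obtain ⟨f', hf'⟩ := exists_schwartzMap_ray γ (k + 1) hθ
  have hint : Integrable (fun σ : ℝ ↦ σ • f σ) := by
    have h := (f'.integrable (μ := volume)).const_mul (-2 * Real.pi * I)⁻¹
    refine h.congr (.of_forall fun σ ↦ ?_)
    have : (Real.pi : ℂ) ≠ 0 := by exact_mod_cast Real.pi_ne_zero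
    simp only [hf, hf', pow_succ, real_smul]
    field_simp
  have h := Real.hasDerivAt_fourier (f.integrable (μ := volume)) hint s
  rw [hf] at h
  refine h.congr_deriv ?_
  refine congrFun (congrArg 𝓕 (funext fun σ ↦ ?_)) s
  simp only [smul_eq_mul]
  ring

omit [FiniteDimensional ℝ V] [MeasurableSpace V] [BorelSpace V] in
-- Uniformity in `θ` is the point: it dominates the integrals for joint continuity in `(θ, s)` and
-- bounds the data independently of direction.
theorem exists_ray_bound (γ : 𝓢(V, ℂ)) (k : ℕ) :
    ∃ C : ℝ, ∀ θ : V, ‖θ‖ = 1 → ∀ σ : ℝ,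
      ‖(-2 * Real.pi * I * σ) ^ k * γ (σ • θ)‖ ≤ C * (1 + ‖σ‖) ^ (-2 : ℝ) := by
  -- Of the `k + 2` powers of decay, `k` absorb the factor `σ^k` and two make the bound integrable
  -- on the line.
  set C := 2 ^ (k + 2) * (Finset.Iic (k + 2, 0)).sup
    (fun m ↦ SchwartzMap.seminorm ℝ m.1 m.2) γ with hC
  refine ⟨(2 * Real.pi) ^ k * C, fun θ hθ σ ↦ ?_⟩
  have h := SchwartzMap.one_add_le_sup_seminorm_apply (𝕜 := ℝ) (m := (k + 2, 0)) le_rfl le_rfl γ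
    (σ • θ)
  simp only [norm_iteratedFDeriv_zero, norm_smul, hθ, mul_one] at h
  rw [← hC] at h
  have hpos : (0 : ℝ) < 1 + ‖σ‖ := by positivity
  rw [norm_mul, norm_pow, norm_mul, norm_mul, norm_mul, Real.rpow_neg hpos.le]
  simp only [norm_neg, norm_I, Complex.norm_real, mul_one, Complex.norm_ofNat]
  rw [Real.norm_of_nonneg Real.pi_pos.le, ← div_eq_mul_inv, le_div_iff₀ (by positivity), mul_pow,
    mul_assoc, mul_assoc]
  gcongr
  refine le_trans ?_ h
  rw [pow_add, Real.rpow_two, mul_comm ‖γ (σ • θ)‖, ← mul_assoc]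
  gcongr
  linarith

theorem integrable_ray_bound (C : ℝ) : Integrable fun σ : ℝ ↦ C * (1 + ‖σ‖) ^ (-2 : ℝ) :=
  (integrable_one_add_norm (by simp)).const_mul C

omit [FiniteDimensional ℝ V] [MeasurableSpace V] [BorelSpace V] in
theorem exists_rayFourier_bound (γ : 𝓢(V, ℂ)) (k : ℕ) :
    ∃ C : ℝ, ∀ θ : V, ‖θ‖ = 1 → ∀ s : ℝ, ‖rayFourier γ k θ s‖ ≤ C := by
  obtain ⟨C, hC⟩ := exists_ray_bound γ k
  refine ⟨∫ σ : ℝ, C * (1 + ‖σ‖) ^ (-2 : ℝ), fun θ hθ s ↦ ?_⟩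
  rw [rayFourier, Real.fourier_eq]
  refine norm_integral_le_of_norm_le (integrable_ray_bound C) (.of_forall fun σ ↦ ?_)
  rw [Circle.norm_smul]
  exact hC θ hθ σ

omit [FiniteDimensional ℝ V] [MeasurableSpace V] [BorelSpace V] in
theorem continuousOn_rayFourier (γ : 𝓢(V, ℂ)) (k : ℕ) :
    ContinuousOn (fun p : V × ℝ ↦ rayFourier γ k p.1 p.2) {p | ‖p.1‖ = 1} := by
  obtain ⟨C, hC⟩ := exists_ray_bound γ k
  simp only [rayFourier, Real.fourier_eq]
  refine continuousOn_of_dominated (bound := fun σ ↦ C * (1 + ‖σ‖) ^ (-2 : ℝ)) ?_ ?_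
    (integrable_ray_bound C) ?_
  · intro p hp
    refine Continuous.aestronglyMeasurable ?_
    have := γ.continuous
    fun_prop
  · intro p hp
    refine .of_forall fun σ ↦ ?_
    rw [Circle.norm_smul]
    exact hC p.1 hp σ
  · refine .of_forall fun σ ↦ Continuous.continuousOn ?_
    have := γ.continuous
    fun_prop

omit [FiniteDimensional ℝ V] [MeasurableSpace V] [BorelSpace V] in
theorem integral_norm_sq_rayFourier (γ : 𝓢(V, ℂ)) (k : ℕ) {θ : V} (hθ : ‖θ‖ = 1) :
    ∫ s, ‖rayFourier γ k θ s‖ ^ 2 =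
      (2 * Real.pi) ^ (2 * k) * ∫ σ : ℝ, σ ^ (2 * k) * ‖γ (σ • θ)‖ ^ 2 := by
  obtain ⟨f, hf⟩ := exists_schwartzMap_ray γ k hθ
  have h := SchwartzMap.integral_norm_sq_fourier f
  rw [fourier_coe, hf] at h
  unfold rayFourier
  rw [h, ← integral_const_mul]
  refine integral_congr_ae (.of_forall fun σ ↦ ?_)
  simp only [norm_mul, norm_pow, norm_neg, norm_I, Complex.norm_real, Complex.norm_ofNat,
    Real.norm_of_nonneg Real.pi_pos.le, mul_pow, ← pow_mul, mul_comm k 2]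
  rw [Real.norm_eq_abs, pow_mul |σ|, sq_abs, ← pow_mul]
  ring

omit [FiniteDimensional ℝ V] [MeasurableSpace V] [BorelSpace V] in
theorem integrable_norm_sq_rayFourier (γ : 𝓢(V, ℂ)) (k : ℕ) {θ : V} (hθ : ‖θ‖ = 1) :
    Integrable fun s ↦ ‖rayFourier γ k θ s‖ ^ 2 := by
  obtain ⟨f, hf⟩ := exists_schwartzMap_ray γ k hθ
  have h := ((𝓕 f).memLp 2 volume).integrable_norm_pow (by norm_num)
  rw [fourier_coe, hf] at h
  exact h

omit [FiniteDimensional ℝ V] [MeasurableSpace V] [BorelSpace V] in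
-- `(θ, s)` and `(-θ, -s)` describe the same hyperplane; each `s`-derivative contributes a sign.
theorem rayFourier_neg (γ : V → ℂ) (k : ℕ) (θ : V) (s : ℝ) :
    rayFourier γ k (-θ) s = (-1) ^ k * rayFourier γ k θ (-s) := by
  unfold rayFourier
  rw [Real.fourier_eq, Real.fourier_eq, ← integral_const_mul, ← integral_neg_eq_self]
  refine integral_congr_ae (.of_forall fun σ ↦ ?_)
  simp only [Circle.smul_def, smul_eq_mul, smul_neg, neg_smul, neg_neg]
  have : (-2 * Real.pi * I * ((-σ : ℝ) : ℂ)) ^ k = (-1) ^ k * (-2 * Real.pi * I * σ) ^ k := by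
    rw [← mul_pow]
    push_cast
    ring
  rw [this]
  simp
  ring

omit [FiniteDimensional ℝ V] [MeasurableSpace V] [BorelSpace V] in
theorem conj_rayFourier {γ : V → ℂ} (hγ : ∀ x, conj (γ x) = γ (-x)) (k : ℕ) (θ : V) (s : ℝ) :
    conj (rayFourier γ k θ s) = rayFourier γ k θ s := by
  unfold rayFourier
  rw [Real.fourier_eq, ← integral_conj, ← integral_neg_eq_self]
  refine integral_congr_ae (.of_forall fun σ ↦ ?_)
  simp only [Circle.smul_def, smul_eq_mul, map_mul, map_pow, hγ, neg_smul, neg_neg]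
  simp [← Circle.coe_inv_eq_conj, AddChar.map_neg_eq_inv, Complex.conj_ofNat]

/-- Fourier slice theorem in weak form, from two exchanges of Fourier transforms: first on the line,
then between `V` and the line through the kernel `e^{2πiσ⟨x, θ⟩}`. -/
theorem integral_rayFourier_mul (γ : 𝓢(V, ℂ)) {θ : V} (hθ : ‖θ‖ = 1) (φ : 𝓢(ℝ, ℂ)) :
    ∫ s, rayFourier γ 0 θ s * φ s = ∫ x, (𝓕 γ : 𝓢(V, ℂ)) x * φ (inner ℝ x θ) := by
  obtain ⟨f, hf⟩ := exists_schwartzMap_ray γ 0 hθ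
  have h1 := SchwartzMap.integral_fourier_mul_eq f φ
  rw [fourier_coe, hf] at h1
  have h2 : ∫ s, rayFourier γ 0 θ s * φ s = ∫ σ, γ (σ • θ) * 𝓕 φ σ := by
    unfold rayFourier
    rw [h1]
    simp
  have h3 := VectorFourier.integral_bilin_fourierIntegral_eq_flip (ContinuousLinearMap.mul ℂ ℂ)
    (μ := (volume : Measure V)) (ν := (volume : Measure ℝ))
    (L := (LinearMap.mul ℝ ℝ) ∘ₗ (-innerₗ V θ))
    Real.continuous_fourierChar (by simp; fun_prop) (𝓕 γ).integrable (𝓕 φ).integrable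
  have h4 (σ : ℝ) : VectorFourier.fourierIntegral Real.fourierChar (volume : Measure V)
      ((LinearMap.mul ℝ ℝ) ∘ₗ (-innerₗ V θ)) (𝓕 γ : 𝓢(V, ℂ)) σ = γ (σ • θ) := by
    have h : (𝓕⁻ (𝓕 γ : 𝓢(V, ℂ)) : 𝓢(V, ℂ)) = γ := FourierTransform.fourierInv_fourier_eq γ
    conv_rhs => rw [← h]
    rw [fourierInv_coe, Real.fourierInv_eq]
    simp [VectorFourier.fourierIntegral, inner_smul_right, real_inner_comm, mul_comm]
  have h5 (x : V) : VectorFourier.fourierIntegral Real.fourierChar (volume : Measure ℝ)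
      ((LinearMap.mul ℝ ℝ) ∘ₗ (-innerₗ V θ)).flip (𝓕 φ : 𝓢(ℝ, ℂ)) x = φ (inner ℝ x θ) := by
    have h : (𝓕⁻ (𝓕 φ : 𝓢(ℝ, ℂ)) : 𝓢(ℝ, ℂ)) = φ := FourierTransform.fourierInv_fourier_eq φ
    conv_rhs => rw [← h]
    rw [fourierInv_coe, Real.fourierInv_eq]
    simp [VectorFourier.fourierIntegral, real_inner_comm, mul_comm]
  simp only [h4, h5, ContinuousLinearMap.mul_apply'] at h3
  rw [h2, h3]

end RayFourier

/-! ### The means over spheres through the origin as a Radon transform. -/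

section OriginMeans

open Set Metric Module Complex FourierTransform SchwartzMap
open scoped ContDiff ComplexConjugate

variable {V : Type*} [NormedAddCommGroup V] [InnerProductSpace ℝ V] [FiniteDimensional ℝ V]
  [MeasurableSpace V] [BorelSpace V]

/-- The function `ξ ↦ |ξ|^(-2(d-1)) h(ξ/|ξ|²)`, where `d` is the dimension of the space. -/
def invTransform (h : V → ℝ) (ξ : V) : ℝ :=
  ((‖ξ‖ ^ 2)⁻¹) ^ (finrank ℝ V - 1) * h ((‖ξ‖ ^ 2)⁻¹ • ξ)

theorem exists_forall_norm_lt_eq_zero {E F : Type*} [NormedAddCommGroup E] [Zero F] {f : E → F}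
    (h0 : (0 : E) ∉ tsupport f) : ∃ ε > 0, ∀ x, ‖x‖ < ε → f x = 0 := by
  obtain ⟨ε, hε, h⟩ := Metric.isOpen_iff.1 (isClosed_tsupport f).isOpen_compl 0 h0
  exact ⟨ε, hε, fun x hx ↦ image_eq_zero_of_notMem_tsupport (h (by simpa using hx))⟩

theorem exists_forall_lt_norm_eq_zero {E F : Type*} [NormedAddCommGroup E] [Zero F] {f : E → F}
    (h0 : HasCompactSupport f) : ∃ R > 0, ∀ x, R < ‖x‖ → f x = 0 := by
  obtain ⟨R, hR, h⟩ := h0.isCompact.isBounded.exists_pos_norm_le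
  exact ⟨R, hR, fun x hx ↦ image_eq_zero_of_notMem_tsupport fun hx' ↦ hx.not_ge (h x hx')⟩

omit [MeasurableSpace V] [BorelSpace V] [FiniteDimensional ℝ V] in
theorem norm_inversion (ξ : V) : ‖(‖ξ‖ ^ 2)⁻¹ • ξ‖ = ‖ξ‖⁻¹ := by
  rcases eq_or_ne ξ 0 with rfl | hx
  · simp
  have hn : ‖ξ‖ ≠ 0 := norm_ne_zero_iff.2 hx
  rw [norm_smul, norm_inv, norm_pow, norm_norm]
  field_simp

omit [MeasurableSpace V] [BorelSpace V] [FiniteDimensional ℝ V] in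
-- Only the origin is delicate: inversion sends points near it to infinity, where `h` vanishes.
theorem contDiff_invTransform {h : V → ℝ} (hc : ContDiff ℝ ∞ h) (hs : HasCompactSupport h)
    (h0 : (0 : V) ∉ tsupport h) : ContDiff ℝ ∞ (invTransform h) := by
  obtain ⟨R, hR, hR'⟩ := exists_forall_lt_norm_eq_zero hs
  refine contDiff_iff_contDiffAt.2 fun ξ ↦ ?_
  rcases eq_or_ne ξ 0 with rfl | hξ
  · have : invTransform h =ᶠ[nhds 0] fun _ ↦ 0 := by
      filter_upwards [ball_mem_nhds (0 : V) (inv_pos.2 hR)] with ξ hξ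
      rcases eq_or_ne ξ 0 with rfl | hne
      · simp [invTransform, image_eq_zero_of_notMem_tsupport h0]
      · rw [invTransform, hR', mul_zero]
        rw [norm_inversion]
        exact (lt_inv_comm₀ hR (norm_pos_iff.2 hne)).2 (by simpa using hξ)
    exact contDiffAt_const.congr_of_eventuallyEq this
  · have hn : ‖ξ‖ ^ 2 ≠ 0 := pow_ne_zero 2 (norm_ne_zero_iff.2 hξ)
    have h1 : ContDiffAt ℝ ∞ (fun ξ : V ↦ (‖ξ‖ ^ 2)⁻¹) ξ :=
      (contDiff_norm_sq ℝ).contDiffAt.inv hn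
    exact (h1.pow _).mul (hc.contDiffAt.comp ξ (h1.smul contDiffAt_id))

omit [MeasurableSpace V] [BorelSpace V] in
theorem hasCompactSupport_invTransform {h : V → ℝ} (h0 : (0 : V) ∉ tsupport h) :
    HasCompactSupport (invTransform h) := by
  obtain ⟨ε, hε, hε'⟩ := exists_forall_norm_lt_eq_zero h0
  refine HasCompactSupport.intro (isCompact_closedBall (0 : V) ε⁻¹) fun ξ hξ ↦ ?_
  have hξ' : ε⁻¹ < ‖ξ‖ := by simpa using hξ
  rw [invTransform, hε', mul_zero]
  rw [norm_inversion]
  exact inv_lt_of_inv_lt₀ hε hξ'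

omit [FiniteDimensional ℝ V] [MeasurableSpace V] [BorelSpace V] in
theorem exists_schwartzMap_eq_ofReal {g : V → ℝ} (hc : ContDiff ℝ ∞ g) (hs : HasCompactSupport g) :
    ∃ G : 𝓢(V, ℂ), ∀ x, G x = g x := by
  have hs' : HasCompactSupport (fun x ↦ (g x : ℂ)) := hs.comp_left (g := ofReal) (by simp)
  have hc' : ContDiff ℝ ∞ (fun x ↦ (g x : ℂ)) := ofRealCLM.contDiff.comp hc
  exact ⟨hs'.toSchwartzMap hc', fun x ↦ rfl⟩

/-- A real-valued test function is the Fourier transform of a Schwartz function with Hermitian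
symmetry. -/
theorem exists_fourier_eq_ofReal {g : V → ℝ} (hc : ContDiff ℝ ∞ g) (hs : HasCompactSupport g) :
    ∃ γ : 𝓢(V, ℂ), (∀ x, (𝓕 γ : 𝓢(V, ℂ)) x = g x) ∧ ∀ x, conj (γ x) = γ (-x) := by
  obtain ⟨G, hG⟩ := exists_schwartzMap_eq_ofReal hc hs
  refine ⟨𝓕⁻ G, fun x ↦ ?_, fun x ↦ ?_⟩
  · rw [FourierTransform.fourier_fourierInv_eq, hG]
  · rw [fourierInv_coe, Real.fourierInv_eq, Real.fourierInv_eq, ← integral_conj]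
    refine integral_congr_ae (.of_forall fun v ↦ ?_)
    simp [hG, Circle.smul_def, ← Circle.coe_inv_eq_conj, AddChar.map_neg_eq_inv]

variable {n : ℕ}

theorem continuous_sphere_integral {h : EuclideanSpace ℝ (Fin n) → ℝ} (hc : Continuous h)
    (θ : EuclideanSpace ℝ (Fin n)) :
    Continuous fun ρ : ℝ ↦ ∫ u : sphere (0 : EuclideanSpace ℝ (Fin n)) 1, h (ρ • θ + ρ • u.1)
      ∂(volume : Measure (EuclideanSpace ℝ (Fin n))).toSphere := by
  have := continuous_parametric_integral_of_continuous (X := ℝ)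
    (μ := (volume : Measure (EuclideanSpace ℝ (Fin n))).toSphere) (s := univ)
    (f := fun ρ u ↦ h (ρ • θ + ρ • u.1)) (by fun_prop) isCompact_univ
  simpa using this

theorem integrable_radial_mul {h : V → ℝ} (hc : Continuous h) (hs : HasCompactSupport h)
    {φ : ℝ → ℝ} (hφ : Continuous φ) (hφs : HasCompactSupport φ) (hφ0 : tsupport φ ⊆ Ioi 0) (θ : V) :
    Integrable fun z : V ↦ ((2 * ‖z‖ ^ 2)⁻¹ * φ ((2 * ‖z‖)⁻¹)) * h (z + ‖z‖ • θ) := by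
  obtain ⟨ε, hε, hε'⟩ := exists_forall_norm_lt_eq_zero (f := φ)
    fun h0 ↦ lt_irrefl _ (mem_Ioi.1 (hφ0 h0))
  -- The singular weight is harmless: with `s = 1/(2|z|)` one has `(2|z|²)⁻¹ = 2s²`, and `2s²φ(s)`
  -- is bounded.
  obtain ⟨A, hA⟩ := (hφs.mul_left (f := fun s : ℝ ↦ 2 * s ^ 2)).exists_bound_of_continuous
    (by fun_prop)
  obtain ⟨B, hB⟩ := hs.exists_bound_of_continuous hc
  have hzero : ∀ z ∉ closedBall (0 : V) ε⁻¹,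
      ((2 * ‖z‖ ^ 2)⁻¹ * φ ((2 * ‖z‖)⁻¹)) * h (z + ‖z‖ • θ) = 0 := by
    intro z hz
    have hz' : ε⁻¹ < ‖z‖ := by simpa using hz
    have hz0 : 0 < ‖z‖ := (inv_pos.2 hε).trans hz'
    rw [hε', mul_zero, zero_mul]
    rw [norm_inv, norm_mul, norm_norm, Real.norm_ofNat]
    refine inv_lt_of_inv_lt₀ hε ?_
    linarith
  rw [← integrableOn_iff_integrable_of_support_subset (s := closedBall (0 : V) ε⁻¹)]
  · refine Measure.integrableOn_of_bounded (M := A * B) measure_closedBall_lt_top.ne ?_ ?_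
    · refine Measurable.aestronglyMeasurable ?_
      have := hφ.measurable
      have := hc.measurable
      fun_prop
    · refine .of_forall fun z ↦ ?_
      rw [norm_mul]
      refine mul_le_mul ?_ (hB _) (norm_nonneg _) ((norm_nonneg _).trans (hA 0))
      have : (2 * ‖z‖ ^ 2)⁻¹ = 2 * ((2 * ‖z‖)⁻¹) ^ 2 := by
        rcases eq_or_ne ‖z‖ 0 with h | h
        · simp [h]
        · field_simp
      rw [this]
      exact hA _
  · intro z hz
    by_contra h
    exact hz (hzero z h)

theorem integral_rayFourier_eq {h : EuclideanSpace ℝ (Fin n) → ℝ} (hh : IsTestAwayFromZero h)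
    {γ : 𝓢(EuclideanSpace ℝ (Fin n), ℂ)}
    (hγ : ∀ x, (𝓕 γ : 𝓢(EuclideanSpace ℝ (Fin n), ℂ)) x = invTransform h x)
    {θ : EuclideanSpace ℝ (Fin n)} (hθ : ‖θ‖ = 1)
    {φ : ℝ → ℝ} (hφ : ContDiff ℝ ∞ φ) (hφs : HasCompactSupport φ) (hφ0 : tsupport φ ⊆ Ioi 0) :
    ∫ s, φ s • rayFourier γ 0 θ s =
      ((∫ s in Ioi (0 : ℝ), φ s * (((2 * s)⁻¹) ^ (n - 1) *
        ∫ u : sphere (0 : EuclideanSpace ℝ (Fin n)) 1, h ((2 * s)⁻¹ • θ + (2 * s)⁻¹ • u.1)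
          ∂(volume : Measure (EuclideanSpace ℝ (Fin n))).toSphere) : ℝ) : ℂ) := by
  have hθ0 : θ ≠ 0 := by rintro rfl; simp at hθ
  have : Nontrivial (EuclideanSpace ℝ (Fin n)) := ⟨θ, 0, hθ0⟩
  obtain ⟨Φ, hΦ⟩ := exists_schwartzMap_eq_ofReal hφ hφs
  have h1 := integral_rayFourier_mul γ hθ Φ
  have h2 : ∫ s, φ s • rayFourier γ 0 θ s = ∫ s, rayFourier γ 0 θ s * Φ s := by
    refine integral_congr_ae (.of_forall fun s ↦ ?_)
    simp [hΦ, mul_comm]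
  have h3 : ∫ x, (𝓕 γ : 𝓢(EuclideanSpace ℝ (Fin n), ℂ)) x * Φ (inner ℝ x θ) =
      ((∫ x, invTransform h x * φ (inner ℝ x θ) : ℝ) : ℂ) := by
    rw [← integral_complex_ofReal]
    refine integral_congr_ae (.of_forall fun s ↦ ?_)
    simp [hΦ, hγ]
  rw [h2, h1, h3, integral_comp_half_inv]
  congr 1
  have hφneg : ∀ s, ¬ 0 < s → φ s = 0 := fun s hs ↦
    image_eq_zero_of_notMem_tsupport fun h' ↦ hs (hφ0 h')
  rw [← setIntegral_eq_integral_of_forall_compl_eq_zero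
      (s := {ξ : EuclideanSpace ℝ (Fin n) | 0 < inner ℝ ξ θ})
      (fun x hx ↦ by rw [hφneg _ hx, mul_zero])]
  have h4 := integral_comp_add_norm_smul hθ (image_eq_zero_of_notMem_tsupport hh.2.2) φ
  have h5 := integral_polar_radius
    (integrable_radial_mul hh.1.continuous hh.2.1 hφ.continuous hφs hφ0 θ)
  unfold invTransform
  rw [← h4, h5]
  refine setIntegral_congr_fun measurableSet_Ioi fun r hr ↦ ?_
  have hr : 0 < r := hr
  have e (u : sphere (0 : EuclideanSpace ℝ (Fin n)) 1) : ‖r • u.1‖ = r := by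
    rw [norm_smul, norm_eq_of_mem_sphere, mul_one, Real.norm_of_nonneg hr.le]
  have e2 : (2 * (2 * r)⁻¹)⁻¹ = r := by field_simp
  simp only [e, e2, integral_const_mul, smul_eq_mul, finrank_euclideanSpace_fin]
  simp only [add_comm (r • θ)]
  ring

/-- Both sides are continuous in `s = 1/(2ρ)` on `(0, ∞)` and have equal pairings with every test
function supported there, so they agree everywhere. -/
theorem weightedOriginMean_eq_rayFourier {h : EuclideanSpace ℝ (Fin n) → ℝ}
    (hh : IsTestAwayFromZero h) {γ : 𝓢(EuclideanSpace ℝ (Fin n), ℂ)}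
    (hγ : ∀ x, (𝓕 γ : 𝓢(EuclideanSpace ℝ (Fin n), ℂ)) x = invTransform h x)
    {θ : EuclideanSpace ℝ (Fin n)} (hθ : ‖θ‖ = 1) {ρ : ℝ} (hρ : 0 < ρ) :
    (weightedOriginMean h (ρ • θ) : ℂ) = (sphereArea n : ℂ)⁻¹ * rayFourier γ 0 θ (2 * ρ)⁻¹ := by
  set W : ℝ → ℝ := fun r ↦ r ^ (n - 1) *
    ∫ u : sphere (0 : EuclideanSpace ℝ (Fin n)) 1, h (r • θ + r • u.1)
      ∂(volume : Measure (EuclideanSpace ℝ (Fin n))).toSphere with hW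
  have hWc : Continuous W := (continuous_pow _).mul (continuous_sphere_integral hh.1.continuous θ)
  have hwc : ContinuousOn (fun s : ℝ ↦ (W (2 * s)⁻¹ : ℂ)) (Ioi 0) := by
    refine (continuous_ofReal.comp hWc).comp_continuousOn ?_
    refine ContinuousOn.inv₀ (by fun_prop) fun s hs ↦ ?_
    have : 0 < s := hs
    positivity
  have hDc : Continuous (rayFourier γ 0 θ) := (contDiff_rayFourier γ 0 hθ).continuous
  have key : EqOn (rayFourier γ 0 θ) (fun s : ℝ ↦ (W (2 * s)⁻¹ : ℂ)) (Ioi 0) := by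
    refine Measure.eqOn_open_of_ae_eq (μ := volume) ?_ isOpen_Ioi hDc.continuousOn hwc
    rw [Filter.EventuallyEq, ae_restrict_iff' measurableSet_Ioi]
    have := isOpen_Ioi.ae_eq_zero_of_integral_contDiff_smul_eq_zero (μ := volume)
      (f := fun s ↦ rayFourier γ 0 θ s - (W (2 * s)⁻¹ : ℂ))
      ((hDc.continuousOn.sub hwc).locallyIntegrableOn measurableSet_Ioi) ?_
    · filter_upwards [this] with s hs hs'
      exact sub_eq_zero.1 (hs hs')
    · intro φ hφ hφs hφ0
      have hi1 : Integrable fun s ↦ φ s • rayFourier γ 0 θ s :=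
        (hφ.continuous.smul hDc).integrable_of_hasCompactSupport hφs.smul_right
      have hi2 : Integrable fun s ↦ φ s • (W (2 * s)⁻¹ : ℂ) := by
        rw [← integrableOn_iff_integrable_of_support_subset (s := tsupport φ)]
        · exact (hφ.continuous.continuousOn.smul (hwc.mono hφ0)).integrableOn_compact hφs
        · exact fun s hs ↦ subset_tsupport φ (Function.mem_support.2 fun h' ↦ hs (by simp [h']))
      have hset : ∫ s, φ s • (W (2 * s)⁻¹ : ℂ) = ∫ s in Ioi 0, φ s • (W (2 * s)⁻¹ : ℂ) :=
        (setIntegral_eq_integral_of_forall_compl_eq_zero fun s hs ↦ by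
          rw [image_eq_zero_of_notMem_tsupport fun h' ↦ hs (hφ0 h'), zero_smul]).symm
      simp only [smul_sub]
      rw [integral_sub hi1 hi2, integral_rayFourier_eq hh hγ hθ hφ hφs hφ0, hset,
        ← integral_complex_ofReal, sub_eq_zero]
      refine setIntegral_congr_fun measurableSet_Ioi fun s hs ↦ ?_
      simp [hW]
  have hs : (2 * ρ)⁻¹ ∈ Ioi (0 : ℝ) := mem_Ioi.2 (inv_pos.2 (by positivity))
  have e : (2 * (2 * ρ)⁻¹)⁻¹ = ρ := by field_simp
  rw [key hs]
  simp only [e]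
  have hn : ‖ρ • θ‖ = ρ := by rw [norm_smul, hθ, mul_one, Real.norm_of_nonneg hρ.le]
  rw [weightedOriginMean, sphericalMean, hn, hW]
  push_cast
  ring

end OriginMeans

/-! ### Regularity, bounds and vanishing near the origin of the differentiated data. -/

section MeanData

open Set Metric Module Complex FourierTransform SchwartzMap
open scoped ContDiff ComplexConjugate

variable {n : ℕ}

section

variable {h : EuclideanSpace ℝ (Fin n) → ℝ} {γ : 𝓢(EuclideanSpace ℝ (Fin n), ℂ)}

theorem contDiffOn_weightedOriginMean (hh : IsTestAwayFromZero h)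
    (hγ : ∀ x, (𝓕 γ : 𝓢(EuclideanSpace ℝ (Fin n), ℂ)) x = invTransform h x)
    {θ : EuclideanSpace ℝ (Fin n)} (hθ : ‖θ‖ = 1) :
    ContDiffOn ℝ ∞ (fun ρ : ℝ ↦ weightedOriginMean h (ρ • θ)) (Ioi 0) := by
  have h1 : ContDiffOn ℝ ∞
      (fun ρ : ℝ ↦ reCLM ((sphereArea n : ℂ)⁻¹ * rayFourier γ 0 θ (2 * ρ)⁻¹)) (Ioi 0) := by
    refine reCLM.contDiff.comp_contDiffOn (contDiffOn_const.mul ?_)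
    refine (contDiff_rayFourier γ 0 hθ).comp_contDiffOn (ContDiffOn.inv (by fun_prop) ?_)
    intro ρ hρ
    have : 0 < ρ := hρ
    positivity
  refine h1.congr fun ρ hρ ↦ ?_
  rw [← weightedOriginMean_eq_rayFourier hh hγ hθ hρ]
  simp

/-- Since `ds/dρ = -1/(2ρ²)` for `s = 1/(2ρ)`, each `ρ²∂_ρ` acts as `-½ ∂_s`. Taking real parts
avoids needing Hermitian symmetry of `γ`. -/
theorem meanData_eq (hh : IsTestAwayFromZero h)
    (hγ : ∀ x, (𝓕 γ : 𝓢(EuclideanSpace ℝ (Fin n), ℂ)) x = invTransform h x) (k : ℕ)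
    {y : EuclideanSpace ℝ (Fin n)} (hy : y ≠ 0) :
    meanData k h y = (sphereArea n)⁻¹ * (-1 / 2) ^ k *
      (rayFourier γ k (‖y‖⁻¹ • y) (2 * ‖y‖)⁻¹).re := by
  induction k generalizing y with
  | zero =>
    have hn : ‖y‖ ≠ 0 := norm_ne_zero_iff.2 hy
    have hθ : ‖‖y‖⁻¹ • y‖ = 1 := norm_smul_inv_norm hy
    have h1 := weightedOriginMean_eq_rayFourier hh hγ hθ (norm_pos_iff.2 hy)
    rw [smul_smul, mul_inv_cancel₀ hn, one_smul] at h1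
    have h2 := congrArg re h1
    rw [ofReal_re, ← ofReal_inv, re_ofReal_mul] at h2
    simpa [meanData] using h2
  | succ k ih =>
    have hn : ‖y‖ ≠ 0 := norm_ne_zero_iff.2 hy
    have hn' : 0 < ‖y‖ := norm_pos_iff.2 hy
    set θ := ‖y‖⁻¹ • y with hθ'
    have hθ : ‖θ‖ = 1 := norm_smul_inv_norm hy
    have hyθ : ‖y‖ • θ = y := by rw [hθ', smul_smul, mul_inv_cancel₀ hn, one_smul]
    rw [meanData, Function.iterate_succ_apply', ← meanData, rhoSqRadialDeriv, radialDeriv,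
      ← hθ', lineDeriv]
    -- For small `t` the point stays on the open ray through `y`, so the direction `θ` is fixed and
    -- only the norm moves.
    have hev : (fun t : ℝ ↦ meanData k h (y + t • θ)) =ᶠ[nhds 0] fun t ↦
        (sphereArea n)⁻¹ * (-1 / 2) ^ k * (rayFourier γ k θ (2 * (‖y‖ + t))⁻¹).re := by
      filter_upwards [Ioi_mem_nhds (show -‖y‖ < 0 by linarith)] with t ht
      have ht' : 0 < ‖y‖ + t := by linarith [mem_Ioi.1 ht]
      have e1 : y + t • θ = (‖y‖ + t) • θ := by rw [add_smul, hyθ]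
      have e2 : ‖y + t • θ‖ = ‖y‖ + t := by
        rw [e1, norm_smul, hθ, mul_one, Real.norm_of_nonneg ht'.le]
      have e3 : ‖y + t • θ‖⁻¹ • (y + t • θ) = θ := by
        rw [e2, e1, smul_smul, inv_mul_cancel₀ ht'.ne', one_smul]
      rw [ih (norm_pos_iff.1 (e2 ▸ ht')), e3, e2]
    have hd : HasDerivAt (fun t : ℝ ↦ (2 * (‖y‖ + t))⁻¹) (-(2 * ‖y‖ ^ 2)⁻¹) 0 := by
      have h := (((hasDerivAt_id (0 : ℝ)).const_add ‖y‖).const_mul 2).inv (by simpa using hn)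
      refine h.congr_deriv ?_
      simp only [id, add_zero]
      field_simp
    have hD := hasDerivAt_rayFourier γ k hθ (2 * (‖y‖ + 0))⁻¹
    have hD' := (reCLM.hasFDerivAt.comp_hasDerivAt _ (hD.scomp 0 hd)).const_mul
      ((sphereArea n)⁻¹ * (-1 / 2) ^ k)
    rw [hev.deriv_eq]
    have := hD'.deriv
    simp only [Function.comp_def, reCLM_apply, add_zero, real_smul] at this
    rw [this, re_ofReal_mul]
    field_simp
    ring

theorem ofReal_meanData_eq (hh : IsTestAwayFromZero h)
    (hγ : ∀ x, (𝓕 γ : 𝓢(EuclideanSpace ℝ (Fin n), ℂ)) x = invTransform h x)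
    (hγ' : ∀ x, conj (γ x) = γ (-x)) (k : ℕ) {y : EuclideanSpace ℝ (Fin n)} (hy : y ≠ 0) :
    (meanData k h y : ℂ) = (sphereArea n : ℂ)⁻¹ * (-1 / 2) ^ k *
      rayFourier γ k (‖y‖⁻¹ • y) (2 * ‖y‖)⁻¹ := by
  rw [meanData_eq hh hγ k hy]
  push_cast
  rw [conj_eq_iff_re.1 (conj_rayFourier hγ' k _ _)]

theorem continuousOn_meanData (hh : IsTestAwayFromZero h)
    (hγ : ∀ x, (𝓕 γ : 𝓢(EuclideanSpace ℝ (Fin n), ℂ)) x = invTransform h x) (k : ℕ) :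
    ContinuousOn (meanData k h) {0}ᶜ := by
  have h1 : ContinuousOn (fun y : EuclideanSpace ℝ (Fin n) ↦ (sphereArea n)⁻¹ * (-1 / 2) ^ k *
      (rayFourier γ k (‖y‖⁻¹ • y) (2 * ‖y‖)⁻¹).re) {0}ᶜ := by
    refine continuousOn_const.mul (continuous_re.comp_continuousOn ?_)
    refine (continuousOn_rayFourier γ k).comp
      (f := fun y : EuclideanSpace ℝ (Fin n) ↦ (‖y‖⁻¹ • y, (2 * ‖y‖)⁻¹)) ?_ ?_
    · have hn : ∀ y ∈ ({0}ᶜ : Set (EuclideanSpace ℝ (Fin n))), ‖y‖ ≠ 0 := fun y hy ↦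
        norm_ne_zero_iff.2 hy
      refine ContinuousOn.prodMk ?_ ?_
      · exact (continuousOn_id.norm.inv₀ hn).smul continuousOn_id
      · exact (continuousOn_const.mul continuousOn_id.norm).inv₀ fun y hy ↦
          mul_ne_zero two_ne_zero (hn y hy)
    · intro y hy
      exact norm_smul_inv_norm hy
  exact h1.congr fun y hy ↦ meanData_eq hh hγ k hy

theorem exists_meanData_bound (hh : IsTestAwayFromZero h)
    (hγ : ∀ x, (𝓕 γ : 𝓢(EuclideanSpace ℝ (Fin n), ℂ)) x = invTransform h x) (k : ℕ) :
    ∃ C : ℝ, ∀ y, y ≠ 0 → |meanData k h y| ≤ C := by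
  obtain ⟨C, hC⟩ := exists_rayFourier_bound γ k
  refine ⟨|(sphereArea n)⁻¹ * (-1 / 2) ^ k| * C, fun y hy ↦ ?_⟩
  rw [meanData_eq hh hγ k hy, abs_mul]
  gcongr
  exact (abs_re_le_norm _).trans (hC _ (norm_smul_inv_norm hy) _)

end

/-- A sphere through the origin with center in the ball of radius `ε/2` stays inside the ball of
radius `ε`, where `h` vanishes. -/
theorem exists_meanData_eq_zero {h : EuclideanSpace ℝ (Fin n) → ℝ} (hh : IsTestAwayFromZero h) :
    ∃ ε > 0, ∀ k, ∀ y, ‖y‖ < ε → meanData k h y = 0 := by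
  obtain ⟨ε, hε, hε'⟩ := exists_forall_norm_lt_eq_zero hh.2.2
  refine ⟨ε / 2, half_pos hε, fun k ↦ ?_⟩
  induction k with
  | zero =>
    intro y hy
    have : ∀ u : sphere (0 : EuclideanSpace ℝ (Fin n)) 1, h (y + ‖y‖ • u.1) = 0 := by
      intro u
      refine hε' _ ((norm_add_le _ _).trans_lt ?_)
      rw [norm_smul, norm_norm, norm_eq_of_mem_sphere]
      linarith
    simp [meanData, weightedOriginMean, sphericalMean, this]
  | succ k ih =>
    intro y hy
    rw [meanData, Function.iterate_succ_apply', ← meanData, rhoSqRadialDeriv, radialDeriv]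
    have hev : meanData k h =ᶠ[nhds y] fun _ ↦ 0 := by
      filter_upwards [isOpen_ball.mem_nhds (show y ∈ ball 0 (ε / 2) by simpa using hy)] with z hz
      exact ih z (by simpa using hz)
    rw [hev.lineDeriv_eq]
    simp [lineDeriv]

end MeanData

/-! ### The isometry. -/

section Isometry

open Set Metric Module Complex FourierTransform SchwartzMap
open scoped ContDiff ComplexConjugate

variable {V : Type*} [NormedAddCommGroup V] [InnerProductSpace ℝ V] [FiniteDimensional ℝ V]
  [MeasurableSpace V] [BorelSpace V]

theorem integral_Ioi_add_comp_neg {f : ℝ → ℝ} (hf : Integrable f) :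
    ∫ s in Ioi (0 : ℝ), (f s + f (-s)) = ∫ s, f s := by
  rw [integral_add hf.integrableOn hf.comp_neg.integrableOn, integral_comp_neg_Ioi, neg_zero,
    add_comm]
  exact intervalIntegral.integral_Iic_add_Ioi hf.integrableOn hf.integrableOn

/-- The integral of `f` in polar coordinates, symmetrized under `x ↦ -x`. -/
theorem two_mul_integral_polar [Nontrivial V] {f : V → ℝ} (hf : Integrable f) :
    2 * ∫ x, f x = ∫ θ : sphere (0 : V) 1,
      (∫ r in Ioi (0 : ℝ), r ^ (finrank ℝ V - 1) * (f (r • θ.1) + f (-(r • θ.1))))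
        ∂(volume : Measure V).toSphere := by
  have h := integral_polar_sphere (hf.add hf.comp_neg)
  rw [show ∫ x, (f + fun x ↦ f (-x)) x = 2 * ∫ x, f x by
    simp only [Pi.add_apply]
    rw [integral_add hf hf.comp_neg, integral_neg_eq_self]
    ring] at h
  simpa using h

theorem integral_comp_inv_Ioi (f : ℝ → ℝ) :
    ∫ s in Ioi (0 : ℝ), f s = ∫ r in Ioi (0 : ℝ), (r ^ 2)⁻¹ * f r⁻¹ := by
  rw [← integral_comp_rpow_Ioi f (p := -1) (by norm_num)]
  refine setIntegral_congr_fun measurableSet_Ioi fun r hr ↦ ?_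
  have hr : 0 < r := hr
  have e : (-1 - 1 : ℝ) = -(2 : ℕ) := by norm_num
  simp only [e, Real.rpow_neg hr.le, Real.rpow_one, Real.rpow_natCast]
  simp

theorem continuous_zpow_norm_mul {V : Type*} [NormedAddCommGroup V] {h : V → ℝ}
    (hc : Continuous h) (h0 : (0 : V) ∉ tsupport h) (m : ℤ) : Continuous fun x : V ↦ ‖x‖ ^ m * |h x| ^ 2 := by
  obtain ⟨ε, hε, hε'⟩ := exists_forall_norm_lt_eq_zero h0
  refine continuous_iff_continuousAt.2 fun x ↦ ?_
  rcases eq_or_ne x 0 with rfl | hx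
  · have : (fun x : V ↦ ‖x‖ ^ m * |h x| ^ 2) =ᶠ[nhds 0] fun _ ↦ 0 := by
      filter_upwards [ball_mem_nhds (0 : V) hε] with z hz
      simp [hε' z (by simpa using hz)]
    exact continuousAt_const.congr this.symm
  · exact (continuousAt_id.norm.zpow₀ m (Or.inl (norm_ne_zero_iff.2 hx))).mul
      (hc.continuousAt.abs.pow 2)

theorem integrable_zpow_norm_mul {h : V → ℝ} (hc : Continuous h) (hs : HasCompactSupport h)
    (h0 : (0 : V) ∉ tsupport h) (m : ℤ) : Integrable fun x : V ↦ ‖x‖ ^ m * |h x| ^ 2 :=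
  (continuous_zpow_norm_mul hc h0 m).integrable_of_hasCompactSupport
    (hs.mono fun x hx ↦ Function.mem_support.2 fun h' ↦ hx (by simp [h']))

/-- The weighted `L²` norm of `h` is the `L²` norm of its transform under inversion. -/
theorem integral_invTransform_sq [Nontrivial V] {h : V → ℝ} (hc : ContDiff ℝ ∞ h)
    (hs : HasCompactSupport h) (h0 : (0 : V) ∉ tsupport h) :
    ∫ x, ‖x‖ ^ (2 * (finrank ℝ V : ℤ) - 4) * |h x| ^ 2 = ∫ ξ, |invTransform h ξ| ^ 2 := by
  have hi : Integrable fun ξ ↦ |invTransform h ξ| ^ 2 :=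
    ((contDiff_invTransform hc hs h0).continuous.abs.pow 2).integrable_of_hasCompactSupport
      ((hasCompactSupport_invTransform h0).mono fun x hx ↦
        Function.mem_support.2 fun h' ↦ hx (by simp [h']))
  rw [integral_polar_sphere (integrable_zpow_norm_mul hc.continuous hs h0 _),
    integral_polar_sphere hi]
  refine integral_congr_ae (.of_forall fun θ ↦ ?_)
  simp only
  rw [integral_comp_inv_Ioi]
  refine setIntegral_congr_fun measurableSet_Ioi fun r hr ↦ ?_
  have hr : 0 < r := hr
  have e (t : ℝ) (ht : 0 < t) : ‖t • θ.1‖ = t := by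
    rw [norm_smul, norm_eq_of_mem_sphere, mul_one, Real.norm_of_nonneg ht.le]
  have e2 : (r ^ 2)⁻¹ • (r • θ.1) = r⁻¹ • θ.1 := by
    rw [smul_smul]
    congr 1
    field_simp
  obtain ⟨d, hd⟩ := Nat.exists_eq_succ_of_ne_zero (finrank_pos (R := ℝ) (M := V)).ne'
  simp only [invTransform, e r hr, e r⁻¹ (inv_pos.2 hr), e2, smul_eq_mul, abs_mul, mul_pow, hd,
    Nat.succ_eq_add_one, Nat.add_sub_cancel]
  rw [abs_of_nonneg (by positivity : (0 : ℝ) ≤ ((r ^ 2)⁻¹) ^ d)]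
  push_cast
  rw [show (2 * ((d : ℤ) + 1) - 4) = (d : ℤ) + d - 2 by ring, zpow_sub₀ (inv_ne_zero hr.ne'),
    zpow_add₀ (inv_ne_zero hr.ne'), zpow_natCast]
  rw [show ((r ^ 2)⁻¹) ^ d = ((r ^ d) ^ 2)⁻¹ by rw [inv_pow, pow_right_comm]]
  simp only [inv_pow, zpow_ofNat]
  field_simp

variable {n : ℕ} {h : EuclideanSpace ℝ (Fin n) → ℝ} {γ : 𝓢(EuclideanSpace ℝ (Fin n), ℂ)}

/-- The data vanish near the origin, where the weight is singular, and are bounded elsewhere, so the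
decay `|y|^(-n-1)` suffices at infinity. -/
theorem integrable_meanData_sq (hn : 0 < n) (hh : IsTestAwayFromZero h)
    (hγ : ∀ x, (𝓕 γ : 𝓢(EuclideanSpace ℝ (Fin n), ℂ)) x = invTransform h x) (k : ℕ) :
    Integrable fun y : EuclideanSpace ℝ (Fin n) ↦
      |meanData k h y| ^ 2 * ‖y‖ ^ (-(n : ℤ) - 1) := by
  have : Nonempty (Fin n) := ⟨⟨0, hn⟩⟩
  have hnt : Nontrivial (EuclideanSpace ℝ (Fin n)) := inferInstance
  obtain ⟨ε, hε, hε'⟩ := exists_meanData_eq_zero hh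
  obtain ⟨C, hC⟩ := exists_meanData_bound hh hγ k
  have hI : Integrable fun y : EuclideanSpace ℝ (Fin n) ↦
      (C ^ 2 * (1 + ε⁻¹) ^ (n + 1)) * (1 + ‖y‖) ^ (-((n + 1 : ℕ) : ℝ)) :=
    (integrable_one_add_norm (by simp)).const_mul _
  refine hI.mono' ?_ (.of_forall fun y ↦ ?_)
  · rw [← restrict_compl_singleton (μ := (volume : Measure (EuclideanSpace ℝ (Fin n)))) 0]
    refine ContinuousOn.aestronglyMeasurable ?_ (measurableSet_singleton _).compl
    exact ((continuousOn_meanData hh hγ k).abs.pow 2).mul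
      (continuousOn_id.norm.zpow₀ _ fun y hy ↦ Or.inl (norm_ne_zero_iff.2 hy))
  · rcases lt_or_ge ‖y‖ ε with hy | hy
    · simp only [hε' k y hy]
      simp
      positivity
    · have hpos : 0 < ‖y‖ := hε.trans_le hy
      have h1 : |meanData k h y| ^ 2 ≤ C ^ 2 := by
        gcongr
        exact hC y (norm_pos_iff.1 hpos)
      have h2 : ‖y‖ ^ (-(n : ℤ) - 1) ≤ (1 + ε⁻¹) ^ (n + 1) * (1 + ‖y‖) ^ (-((n + 1 : ℕ) : ℝ)) := by
        rw [Real.rpow_neg (by positivity), Real.rpow_natCast,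
          show -(n : ℤ) - 1 = -((n + 1 : ℕ) : ℤ) by push_cast; ring, zpow_neg, zpow_natCast,
          ← div_eq_mul_inv, inv_eq_one_div, div_le_div_iff₀ (by positivity) (by positivity),
          one_mul, ← mul_pow]
        gcongr
        have : 1 ≤ ε⁻¹ * ‖y‖ := by
          rw [← div_eq_inv_mul, le_div_iff₀ hε]
          linarith
        linarith
      rw [Real.norm_of_nonneg (by positivity), mul_assoc]
      gcongr

/-- Opposite rays are paired because Plancherel lives on the full line: the data at `-rθ` supply the
values at `-s`. The resulting `σ^(2m)` is the polar density `r^(n-1)`. -/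
theorem integral_meanData_sq {m : ℕ} (hn : n = 2 * m + 1) (hh : IsTestAwayFromZero h)
    (hγ : ∀ x, (𝓕 γ : 𝓢(EuclideanSpace ℝ (Fin n), ℂ)) x = invTransform h x)
    (hγ' : ∀ x, conj (γ x) = γ (-x)) :
    ∫ y : EuclideanSpace ℝ (Fin n), |meanData m h y| ^ 2 * ‖y‖ ^ (-(n : ℤ) - 1) =
      2 * (sphereArea n)⁻¹ ^ 2 * Real.pi ^ (2 * m) * ∫ ξ, |invTransform h ξ| ^ 2 := by
  have : Nonempty (Fin n) := ⟨⟨0, by omega⟩⟩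
  have hnt : Nontrivial (EuclideanSpace ℝ (Fin n)) := inferInstance
  have hplanch : ∫ x, ‖γ x‖ ^ 2 = ∫ ξ, |invTransform h ξ| ^ 2 := by
    rw [← SchwartzMap.integral_norm_sq_fourier γ]
    refine integral_congr_ae (.of_forall fun ξ ↦ ?_)
    simp [hγ]
  have hγi : Integrable fun x ↦ ‖γ x‖ ^ 2 := (γ.memLp 2 volume).integrable_norm_pow (by norm_num)
  have hA := two_mul_integral_polar (integrable_meanData_sq (by omega) hh hγ m)
  have hB := two_mul_integral_polar hγi
  have hinner (θ : sphere (0 : EuclideanSpace ℝ (Fin n)) 1) :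
      ∫ r in Ioi (0 : ℝ), r ^ (finrank ℝ (EuclideanSpace ℝ (Fin n)) - 1) *
        (|meanData m h (r • θ.1)| ^ 2 * ‖r • θ.1‖ ^ (-(n : ℤ) - 1) +
          |meanData m h (-(r • θ.1))| ^ 2 * ‖-(r • θ.1)‖ ^ (-(n : ℤ) - 1)) =
      (2 * (sphereArea n)⁻¹ ^ 2 * Real.pi ^ (2 * m)) *
        ∫ r in Ioi (0 : ℝ), r ^ (finrank ℝ (EuclideanSpace ℝ (Fin n)) - 1) *
          (‖γ (r • θ.1)‖ ^ 2 + ‖γ (-(r • θ.1))‖ ^ 2) := by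
    have hθ : ‖θ.1‖ = 1 := norm_eq_of_mem_sphere θ
    have hθ' : ‖-θ.1‖ = 1 := by rw [norm_neg, hθ]
    have hmean (v : EuclideanSpace ℝ (Fin n)) (hv : ‖v‖ = 1) (r : ℝ) (hr : 0 < r) :
        |meanData m h (r • v)| ^ 2 = ((sphereArea n)⁻¹ ^ 2 * (1 / 4) ^ m) *
          ‖rayFourier γ m v (2 * r)⁻¹‖ ^ 2 := by
      have e : ‖r • v‖ = r := by rw [norm_smul, hv, mul_one, Real.norm_of_nonneg hr.le]
      have e2 : r⁻¹ • (r • v) = v := by rw [smul_smul, inv_mul_cancel₀ hr.ne', one_smul]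
      have := ofReal_meanData_eq hh hγ hγ' m (y := r • v) (norm_pos_iff.1 (by rw [e]; exact hr))
      rw [e, e2] at this
      rw [← Real.norm_eq_abs, ← Complex.norm_real, this, norm_mul, norm_mul, mul_pow, mul_pow,
        norm_inv, Complex.norm_real, ← norm_inv, Real.norm_eq_abs, sq_abs, norm_pow,
        pow_right_comm]
      norm_num
    have hfull := integral_norm_sq_rayFourier γ m hθ
    have hi2 : Integrable fun σ : ℝ ↦ σ ^ (2 * m) * ‖γ (σ • θ.1)‖ ^ 2 := by
      obtain ⟨f, hf⟩ := exists_schwartzMap_ray γ m hθ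
      have h1 := ((f.memLp 2 volume).integrable_norm_pow (by norm_num)).const_mul
        ((2 * Real.pi) ^ (2 * m))⁻¹
      refine h1.congr (.of_forall fun σ ↦ ?_)
      simp only [hf, norm_mul, norm_pow, norm_neg, norm_I, Complex.norm_real, Complex.norm_ofNat,
        Real.norm_of_nonneg Real.pi_pos.le, mul_pow, ← pow_mul, mul_comm m 2]
      rw [Real.norm_eq_abs, pow_mul |σ|, sq_abs, ← pow_mul, one_pow, mul_one]
      field_simp
    rw [← integral_Ioi_add_comp_neg (integrable_norm_sq_rayFourier γ m hθ),
      ← integral_Ioi_add_comp_neg hi2, integral_comp_half_inv] at hfull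
    have hR : ∫ r in Ioi (0 : ℝ), r ^ (finrank ℝ (EuclideanSpace ℝ (Fin n)) - 1) *
          (‖γ (r • θ.1)‖ ^ 2 + ‖γ (-(r • θ.1))‖ ^ 2) =
        ∫ σ in Ioi (0 : ℝ), (σ ^ (2 * m) * ‖γ (σ • θ.1)‖ ^ 2 +
          (-σ) ^ (2 * m) * ‖γ ((-σ) • θ.1)‖ ^ 2) := by
      refine setIntegral_congr_fun measurableSet_Ioi fun r hr ↦ ?_
      simp only [finrank_euclideanSpace_fin, hn, Nat.add_sub_cancel, neg_smul,
        (even_two_mul m).neg_pow]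
      ring
    have hL : ∫ r in Ioi (0 : ℝ), r ^ (finrank ℝ (EuclideanSpace ℝ (Fin n)) - 1) *
        (|meanData m h (r • θ.1)| ^ 2 * ‖r • θ.1‖ ^ (-(n : ℤ) - 1) +
          |meanData m h (-(r • θ.1))| ^ 2 * ‖-(r • θ.1)‖ ^ (-(n : ℤ) - 1)) =
        (2 * ((sphereArea n)⁻¹ ^ 2 * (1 / 4) ^ m)) * ∫ r in Ioi (0 : ℝ), (2 * r ^ 2)⁻¹ •
          (‖rayFourier γ m θ.1 (2 * r)⁻¹‖ ^ 2 + ‖rayFourier γ m θ.1 (-(2 * r)⁻¹)‖ ^ 2) := by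
      rw [← integral_const_mul]
      refine setIntegral_congr_fun measurableSet_Ioi fun r hr ↦ ?_
      have hr : 0 < r := hr
      have e : ‖r • θ.1‖ = r := by rw [norm_smul, hθ, mul_one, Real.norm_of_nonneg hr.le]
      have e' : ‖r • -θ.1‖ = r := by rw [norm_smul, hθ', mul_one, Real.norm_of_nonneg hr.le]
      have e3 : ‖rayFourier γ m (-θ.1) (2 * r)⁻¹‖ = ‖rayFourier γ m θ.1 (-(2 * r)⁻¹)‖ := by
        rw [rayFourier_neg]
        simp
      -- The first factor cancels the polar density; `r⁻² dr` is `2 ds` up to orientation.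
      have e4 : r ^ (-(n : ℤ) - 1) = (r ^ (2 * m))⁻¹ * (r ^ 2)⁻¹ := by
        rw [hn, show -((2 * m + 1 : ℕ) : ℤ) - 1 = -((2 * m + 2 : ℕ) : ℤ) by push_cast; ring,
          zpow_neg, zpow_natCast, pow_add, mul_inv]
      simp only [e, e', ← smul_neg, hmean _ hθ r hr, hmean _ hθ' r hr, e3, e4,
        finrank_euclideanSpace_fin, smul_eq_mul]
      rw [show n - 1 = 2 * m by omega]
      field_simp
    rw [hL, hfull, hR]
    -- The factor `1/4` is the square of the `-½` from each `ρ²∂_ρ`; `2π` comes from each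
    -- `s`-derivative.
    have : (1 / 4 : ℝ) ^ m * (2 * Real.pi) ^ (2 * m) = Real.pi ^ (2 * m) := by
      rw [pow_mul, pow_mul, ← mul_pow]
      congr 1
      ring
    rw [← this]
    ring
  simp only [hinner, integral_const_mul] at hA
  rw [← hB, hplanch] at hA
  linarith

end Isometry

/-! ### Cone coordinates and the inversion formula. -/

section Inversion

open Set Metric Module Complex FourierTransform SchwartzMap
open scoped ContDiff ComplexConjugate

variable {V : Type*} [NormedAddCommGroup V] [InnerProductSpace ℝ V] [FiniteDimensional ℝ V]
  [MeasurableSpace V] [BorelSpace V]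
variable {F : Type*} [NormedAddCommGroup F] [NormedSpace ℝ F]

/-- Cartesian coordinates `(t, v) ↦ t e + v` along a unit vector `e` and its orthogonal
complement. -/
def lineOrthogonalEquiv {e : V} (he : ‖e‖ = 1) : ℝ × (ℝ ∙ e)ᗮ ≃ᵐ V :=
  ((LinearIsometryEquiv.toSpanUnitSingleton (𝕜 := ℝ) e he).toMeasurableEquiv.prodCongr
    (MeasurableEquiv.refl (ℝ ∙ e)ᗮ)).trans ((ℝ ∙ e).measurableEquivProd (0 : V)).symm

theorem lineOrthogonalEquiv_apply {e : V} (he : ‖e‖ = 1) (p : ℝ × (ℝ ∙ e)ᗮ) :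
    lineOrthogonalEquiv he p = p.1 • e + p.2.1 := by
  simp [lineOrthogonalEquiv, MeasurableEquiv.prodCongr]

theorem measurePreserving_lineOrthogonalEquiv {e : V} (he : ‖e‖ = 1) :
    MeasurePreserving (lineOrthogonalEquiv he) volume volume := by
  have h1 := ((ℝ ∙ e).measurePreserving_measurableEquivProd (0 : V)).symm
  rw [InnerProductSpace.euclideanHausdorffMeasure_eq_volume] at h1
  have h2 := (LinearIsometryEquiv.toSpanUnitSingleton (𝕜 := ℝ) e he).measurePreserving.prod
    (MeasurePreserving.id (volume : Measure (ℝ ∙ e)ᗮ))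
  exact h1.comp h2

theorem integrable_line_orthogonal {F : Type*} [NormedAddCommGroup F] {e : V}
    (he : ‖e‖ = 1) {f : V → F} (hf : Integrable f) :
    Integrable fun p : ℝ × (ℝ ∙ e)ᗮ ↦ f (p.1 • e + p.2.1) := by
  have := (measurePreserving_lineOrthogonalEquiv he).integrable_comp_of_integrable hf
  simpa only [Function.comp_def, lineOrthogonalEquiv_apply] using this

theorem integral_line_orthogonal {e : V} (he : ‖e‖ = 1) (f : V → F) :
    ∫ x, f x = ∫ p : ℝ × (ℝ ∙ e)ᗮ, f (p.1 • e + p.2.1) := by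
  have := (measurePreserving_lineOrthogonalEquiv he).integral_comp' f
  simpa only [lineOrthogonalEquiv_apply] using this.symm

omit [MeasurableSpace V] [BorelSpace V] in
theorem finrank_orthogonal_unit {e : V} (he : ‖e‖ = 1) :
    finrank ℝ (ℝ ∙ e)ᗮ = finrank ℝ V - 1 := by
  have h := (ℝ ∙ e).finrank_add_finrank_orthogonal
  rw [finrank_span_singleton (by rintro rfl; simp at he)] at h
  omega

theorem integral_norm_cone_eq {e : V} (he : ‖e‖ = 1) (f : V → F) {t : ℝ} (ht : t ≠ 0) :
    |t| ^ (finrank ℝ V - 1) • ∫ w : (ℝ ∙ e)ᗮ, f (t • (e + w.1)) =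
      ∫ v : (ℝ ∙ e)ᗮ, f (t • e + v.1) := by
  have h := Measure.integral_comp_smul (volume : Measure (ℝ ∙ e)ᗮ) (fun v ↦ f (t • e + v.1)) t
  simp only [Submodule.coe_smul, ← smul_add] at h
  rw [h, smul_smul, finrank_orthogonal_unit he, abs_inv, abs_pow, mul_inv_cancel₀ (by positivity),
    one_smul]

/-- The coordinates `(t, w) ↦ t (e + w)` with `w` orthogonal to `e` have Jacobian `|t|^(d-1)`. -/
theorem integrable_cone {e : V} (he : ‖e‖ = 1) {f : V → F} (hf : Integrable f)
    (hc : Continuous f) :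
    Integrable fun p : ℝ × (ℝ ∙ e)ᗮ ↦ |p.1| ^ (finrank ℝ V - 1) • f (p.1 • (e + p.2.1)) := by
  have hi := integrable_line_orthogonal he hf
  have hne : ∀ᵐ t : ℝ, t ≠ 0 := by simp [ae_iff]
  have hmeas : AEStronglyMeasurable
      (fun p : ℝ × (ℝ ∙ e)ᗮ ↦ |p.1| ^ (finrank ℝ V - 1) • f (p.1 • (e + p.2.1))) volume :=
    Continuous.aestronglyMeasurable (by fun_prop)
  refine (integrable_prod_iff hmeas).2 ⟨?_, ?_⟩
  · filter_upwards [hi.prod_right_ae, hne] with t ht ht0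
    refine Integrable.smul (|t| ^ (finrank ℝ V - 1)) ?_
    have h := (integrable_comp_smul_iff (volume : Measure (ℝ ∙ e)ᗮ)
      (fun v ↦ f (t • e + v.1)) ht0).2 ht
    simpa only [Submodule.coe_smul, ← smul_add] using h
  · refine hi.norm.integral_prod_left.congr ?_
    filter_upwards [hne] with t ht0
    have h := integral_norm_cone_eq he (fun x ↦ ‖f x‖) ht0
    simp only [norm_smul, norm_pow, Real.norm_eq_abs, abs_abs, integral_const_mul]
    exact h.symm

/-- Lines through the origin are indexed by where they meet the affine hyperplane `e + eᗮ`, rather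
than by directions on the sphere. This is what turns Fourier inversion into an integral over a
hyperplane of centers. -/
theorem integral_cone {e : V} (he : ‖e‖ = 1) {f : V → F} (hf : Integrable f)
    (hc : Continuous f) :
    ∫ x, f x = ∫ w : (ℝ ∙ e)ᗮ, ∫ t : ℝ, |t| ^ (finrank ℝ V - 1) • f (t • (e + w.1)) := by
  have hne : ∀ᵐ t : ℝ, t ≠ 0 := by simp [ae_iff]
  rw [integral_line_orthogonal he, ← integral_prod_symm _ (integrable_cone he hf hc),
    integral_prod _ (integrable_cone he hf hc)]
  erw [integral_prod _ (integrable_line_orthogonal he hf)]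
  refine integral_congr_ae ?_
  filter_upwards [hne] with t ht0
  simp only [integral_smul]
  exact (integral_norm_cone_eq he f ht0).symm

omit [FiniteDimensional ℝ V] [MeasurableSpace V] [BorelSpace V] in
-- The substitution `σ = t|z|` normalizes the direction.
theorem integral_line_eq_rayFourier (γ : V → ℂ) (k : ℕ) {z : V} (hz : z ≠ 0) (c : ℝ) :
    ∫ t : ℝ, ((t : ℂ) ^ k * (Real.fourierChar (-(t * c)) • γ (t • z))) =
      ((‖z‖ : ℂ) ^ (k + 1))⁻¹ * ((-2 * Real.pi * I) ^ k)⁻¹ *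
        rayFourier γ k (‖z‖⁻¹ • z) (c / ‖z‖) := by
  have hn : ‖z‖ ≠ 0 := norm_ne_zero_iff.2 hz
  have hn' : (‖z‖ : ℂ) ≠ 0 := by exact_mod_cast hn
  have hpi : (-2 * Real.pi * I : ℂ) ≠ 0 := by simp [Real.pi_ne_zero]
  rw [rayFourier, Real.fourier_eq]
  have h := Measure.integral_comp_mul_right (fun σ : ℝ ↦ Real.fourierChar (-inner ℝ σ (c / ‖z‖)) •
    ((-2 * Real.pi * I * σ) ^ k * γ (σ • ‖z‖⁻¹ • z))) ‖z‖
  rw [abs_inv, abs_norm, eq_inv_smul_iff₀ hn] at h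
  rw [← h, real_smul, ← integral_const_mul, ← integral_const_mul]
  refine integral_congr_ae (.of_forall fun t ↦ ?_)
  have e1 : (t * ‖z‖) • ‖z‖⁻¹ • z = t • z := by
    rw [smul_smul, mul_assoc, mul_inv_cancel₀ hn, mul_one]
  have e2 : -inner ℝ (t * ‖z‖) (c / ‖z‖) = -(t * c) := by
    simp
    field_simp
  simp only [e1, e2, Circle.smul_def, smul_eq_mul]
  push_cast
  have e3 : (-2 * Real.pi * I * ((t : ℂ) * ‖z‖)) ^ k =
      (-2 * Real.pi * I) ^ k * ((t : ℂ) ^ k * (‖z‖ : ℂ) ^ k) := by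
    rw [mul_pow _ ((t : ℂ) * ‖z‖), mul_pow (t : ℂ)]
  rw [e3]
  generalize (-2 * Real.pi * I : ℂ) = w at hpi
  field_simp
  ring

variable {n : ℕ}

theorem sphereArea_sq (hn : n ≠ 0) :
    sphereArea n ^ 2 = 4 * Real.pi ^ n / Real.Gamma (n / 2) ^ 2 := by
  have : Nonempty (Fin n) := ⟨⟨0, by omega⟩⟩
  have hn' : (0 : ℝ) < n := by exact_mod_cast Nat.pos_of_ne_zero hn
  have hΓ := Real.Gamma_pos_of_pos (half_pos hn')
  rw [sphereArea, Measure.toSphere_real_apply_univ, finrank_euclideanSpace_fin, Measure.real,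
    EuclideanSpace.volume_ball, Real.Gamma_add_one (by simpa using hn)]
  simp only [Fintype.card_fin, ENNReal.ofReal_one, one_pow, one_mul]
  rw [ENNReal.toReal_ofReal (by positivity), mul_pow, div_pow, pow_right_comm,
    Real.sq_sqrt Real.pi_pos.le]
  field_simp
  norm_num

theorem sphereArea_ne_zero (hn : n ≠ 0) : sphereArea n ≠ 0 := by
  have hn' : (0 : ℝ) < n := by exact_mod_cast Nat.pos_of_ne_zero hn
  have hΓ := Real.Gamma_pos_of_pos (half_pos hn')
  have := Real.pi_pos
  refine pow_ne_zero_iff two_ne_zero |>.1 ?_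
  rw [sphereArea_sq hn]
  positivity

/-- The map is an isometric embedding onto the bisector, and `μHE` agrees with Lebesgue measure on
inner product spaces of the matching dimension. -/
theorem map_orthogonal_eq_restrict_bisector {e : EuclideanSpace ℝ (Fin n)} (he : ‖e‖ = 1)
    {r : ℝ} (hr : 0 < r) :
    (volume : Measure (ℝ ∙ e)ᗮ).map (fun v ↦ r • e + v.1) =
      (μHE[n - 1] : Measure (EuclideanSpace ℝ (Fin n))).restrict (bisector ((2 * r) • e)) := by
  have hiso : Isometry fun v : (ℝ ∙ e)ᗮ ↦ r • e + v.1 :=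
    (isometry_add_left (r • e)).comp isometry_subtype_coe
  have hrange : range (fun v : (ℝ ∙ e)ᗮ ↦ r • e + v.1) = bisector ((2 * r) • e) := by
    ext y
    simp only [mem_range, Subtype.exists, bisector, mem_ofPred_eq, norm_smul, he,
      inner_smul_right, Real.norm_of_nonneg (by positivity : 0 ≤ 2 * r),
      Submodule.mem_orthogonal_singleton_iff_inner_left]
    constructor
    · rintro ⟨v, hv, rfl⟩
      rw [inner_add_left, inner_smul_left, hv, real_inner_self_eq_norm_sq, he]
      simp
      ring
    · intro hy
      refine ⟨y - r • e, ?_, by abel⟩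
      rw [inner_sub_left, inner_smul_left, real_inner_self_eq_norm_sq, he]
      simp
      have : (4 * r) * (inner ℝ y e - r) = 0 := by linear_combination hy
      exact (mul_eq_zero.1 this).resolve_left (by positivity)
  rw [← hrange, ← hiso.map_euclideanHausdorffMeasure,
    ← InnerProductSpace.euclideanHausdorffMeasure_eq_volume, finrank_orthogonal_unit he,
    finrank_euclideanSpace_fin]

theorem integral_bisector {e : EuclideanSpace ℝ (Fin n)} (he : ‖e‖ = 1) {r : ℝ} (hr : 0 < r)
    (Q : EuclideanSpace ℝ (Fin n) → ℝ) :
    ∫ y in bisector ((2 * r) • e), Q y ∂μHE[n - 1] =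
      r ^ (n - 1) * ∫ w : (ℝ ∙ e)ᗮ, Q (r • (e + w.1)) := by
  have hemb : MeasurableEmbedding fun v : (ℝ ∙ e)ᗮ ↦ r • e + v.1 :=
    (Homeomorph.addLeft (r • e)).measurableEmbedding.comp
      (MeasurableEmbedding.subtype_coe (Submodule.closed_of_finiteDimensional _).measurableSet)
  rw [← map_orthogonal_eq_restrict_bisector he hr, hemb.integral_map]
  have h := integral_norm_cone_eq he Q hr.ne'
  rw [finrank_euclideanSpace_fin, abs_of_pos hr] at h
  exact h.symm

theorem integrableOn_bisector {e : EuclideanSpace ℝ (Fin n)} (he : ‖e‖ = 1) {r : ℝ} (hr : 0 < r)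
    {Q : EuclideanSpace ℝ (Fin n) → ℝ}
    (hQ : Integrable fun w : (ℝ ∙ e)ᗮ ↦ Q (r • (e + w.1))) :
    IntegrableOn Q (bisector ((2 * r) • e)) μHE[n - 1] := by
  have hemb : MeasurableEmbedding fun v : (ℝ ∙ e)ᗮ ↦ r • e + v.1 :=
    (Homeomorph.addLeft (r • e)).measurableEmbedding.comp
      (MeasurableEmbedding.subtype_coe (Submodule.closed_of_finiteDimensional _).measurableSet)
  rw [IntegrableOn, ← map_orthogonal_eq_restrict_bisector he hr, hemb.integrable_map_iff]
  rw [← integrable_comp_smul_iff _ _ hr.ne']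
  simpa only [Function.comp_def, Submodule.coe_smul, ← smul_add] using hQ

variable {h : EuclideanSpace ℝ (Fin n) → ℝ} {γ : 𝓢(EuclideanSpace ℝ (Fin n), ℂ)}

/-- For `ξ = e/(2r)` the phase `⟨t(e + w), ξ⟩ = t/(2r)` does not depend on `w`. After normalizing
the direction, the frequency is `1/(2r|e + w|) = 1/(2|y|)` with `y = r(e + w)`, precisely the
parameter of the data at `y`. -/
theorem integral_meanData_cone {m : ℕ} (hn : n = 2 * m + 1) (hh : IsTestAwayFromZero h)
    (hγ : ∀ x, (𝓕 γ : 𝓢(EuclideanSpace ℝ (Fin n), ℂ)) x = invTransform h x)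
    (hγ' : ∀ x, conj (γ x) = γ (-x))
    {e : EuclideanSpace ℝ (Fin n)} (he : ‖e‖ = 1) {r : ℝ} (hr : 0 < r) :
    (Integrable fun w : (ℝ ∙ e)ᗮ ↦
      ‖r • (e + w.1)‖ ^ (-(n : ℤ)) * meanData (n - 1) h (r • (e + w.1))) ∧
    invTransform h ((2 * r)⁻¹ • e) = (r ^ n * (-1) ^ m * sphereArea n / Real.pi ^ (n - 1)) *
      ∫ w : (ℝ ∙ e)ᗮ, ‖r • (e + w.1)‖ ^ (-(n : ℤ)) * meanData (n - 1) h (r • (e + w.1)) := by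
  have : Nonempty (Fin n) := ⟨⟨0, by omega⟩⟩
  have hnt : Nontrivial (EuclideanSpace ℝ (Fin n)) := inferInstance
  have hω : sphereArea n ≠ 0 := sphereArea_ne_zero (by omega)
  set ξ := (2 * r)⁻¹ • e with hξ
  set f : EuclideanSpace ℝ (Fin n) → ℂ := fun η ↦ Real.fourierChar (-inner ℝ η ξ) • γ η with hf
  have hfc : Continuous f := by
    have := γ.continuous
    fun_prop
  have hfi : Integrable f := by
    refine (γ.integrable (μ := volume)).mono hfc.aestronglyMeasurable (.of_forall fun η ↦ ?_)
    rw [hf, Circle.norm_smul]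
  have hperp (w : (ℝ ∙ e)ᗮ) : inner ℝ w.1 e = 0 :=
    Submodule.mem_orthogonal_singleton_iff_inner_left.1 w.2
  have hinn (w : (ℝ ∙ e)ᗮ) : inner ℝ (e + w.1) ξ = (2 * r)⁻¹ := by
    rw [hξ, inner_smul_right, inner_add_left, hperp, real_inner_self_eq_norm_sq, he]
    simp
  have hz (w : (ℝ ∙ e)ᗮ) : e + w.1 ≠ 0 := by
    intro h0
    have := hinn w
    rw [h0, inner_zero_left] at this
    have : 0 < (2 * r)⁻¹ := by positivity
    linarith
  have hslice (w : (ℝ ∙ e)ᗮ) :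
      ∫ t : ℝ, |t| ^ (finrank ℝ (EuclideanSpace ℝ (Fin n)) - 1) • f (t • (e + w.1)) =
        ((r ^ n * (-1) ^ m * sphereArea n / Real.pi ^ (n - 1) *
          (‖r • (e + w.1)‖ ^ (-(n : ℤ)) * meanData (n - 1) h (r • (e + w.1))) : ℝ) : ℂ) := by
    have hN : ‖e + w.1‖ ≠ 0 := norm_ne_zero_iff.2 (hz w)
    have h1 := integral_line_eq_rayFourier γ (2 * m) (hz w) (2 * r)⁻¹
    have h2 := ofReal_meanData_eq hh hγ hγ' (2 * m) (smul_ne_zero hr.ne' (hz w))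
    have hnorm : ‖r • (e + w.1)‖ = r * ‖e + w.1‖ := by
      rw [norm_smul, Real.norm_of_nonneg hr.le]
    have e1 : (r * ‖e + w.1‖)⁻¹ • r • (e + w.1) = ‖e + w.1‖⁻¹ • (e + w.1) := by
      rw [smul_smul]
      congr 1
      field_simp
    have e2 : (2 * (r * ‖e + w.1‖))⁻¹ = (2 * r)⁻¹ / ‖e + w.1‖ := by
      field_simp
    rw [hnorm, e1, e2] at h2
    -- Oddness of `n` enters here: `|t|^(n-1) = t^(n-1)`, so the Jacobian amounts to differentiation
    -- in `s`.
    have h3 : ∫ t : ℝ, |t| ^ (finrank ℝ (EuclideanSpace ℝ (Fin n)) - 1) • f (t • (e + w.1)) =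
        ∫ t : ℝ, ((t : ℂ) ^ (2 * m) *
          (Real.fourierChar (-(t * (2 * r)⁻¹)) • γ (t • (e + w.1)))) := by
      refine integral_congr_ae (.of_forall fun t ↦ ?_)
      simp only [hf, inner_smul_left, hinn, finrank_euclideanSpace_fin, hn, Nat.add_sub_cancel,
        real_smul]
      rw [(even_two_mul m).pow_abs]
      simp
    rw [h3, h1]
    have hω' : (sphereArea n : ℂ) ≠ 0 := by exact_mod_cast hω
    have h4 : rayFourier γ (2 * m) (‖e + w.1‖⁻¹ • (e + w.1)) ((2 * r)⁻¹ / ‖e + w.1‖) =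
        sphereArea n * (4 ^ m) * meanData (2 * m) h (r • (e + w.1)) := by
      rw [h2, pow_mul]
      have : ((-1 / 2 : ℂ) ^ 2) ^ m = (4 ^ m)⁻¹ := by
        rw [← inv_pow]
        congr 1
        norm_num
      rw [this]
      field_simp
    have hN' : (‖e + w.1‖ : ℂ) ≠ 0 := by exact_mod_cast hN
    have hpow (t : ℝ) : t ^ n = t ^ (2 * m + 1) := by rw [hn]
    have hr' : (r : ℂ) ≠ 0 := by exact_mod_cast hr.ne'
    have hpi : (Real.pi : ℂ) ≠ 0 := by exact_mod_cast Real.pi_ne_zero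
    have h5 :
        ((-2 * Real.pi * I : ℂ) ^ (2 * m))⁻¹ = (-1) ^ m * (4 ^ m)⁻¹ *
          ((Real.pi : ℂ) ^ (2 * m))⁻¹ := by
      have : (-2 * Real.pi * I : ℂ) ^ 2 = -1 * 4 * (Real.pi : ℂ) ^ 2 := by
        rw [mul_pow, I_sq]
        ring
      rw [pow_mul, this, mul_pow, mul_pow, mul_inv, mul_inv, pow_mul, ← inv_pow (-1 : ℂ),
        inv_neg_one]
    rw [h4, h5, hnorm, show n - 1 = 2 * m by omega, zpow_neg, zpow_natCast, hpow, hpow]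
    push_cast
    field_simp
    rw [mul_pow]
    ring
  have hC : (r ^ n * (-1) ^ m * sphereArea n / Real.pi ^ (n - 1)) ≠ 0 := by
    have := Real.pi_pos
    positivity
  have hint := (integrable_cone he hfi hfc).integral_prod_right
  simp only [hslice] at hint
  refine ⟨?_, ?_⟩
  · have h1 := hint.re
    simp only [RCLike.re_to_complex, ofReal_re] at h1
    exact (integrable_const_mul_iff (IsUnit.mk0 _ hC) _).1 h1
  · have h1 := hγ ξ
    rw [fourier_coe, Real.fourier_eq, integral_cone he hfi hfc] at h1
    simp only [hslice] at h1
    rw [integral_complex_ofReal, integral_const_mul] at h1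
    exact_mod_cast h1.symm

end Inversion

/-! ### Assembly of the two formulas. -/

section Main

open Set Metric Module Complex FourierTransform SchwartzMap
open scoped ContDiff ComplexConjugate

variable {n : ℕ} {h : EuclideanSpace ℝ (Fin n) → ℝ}

theorem exists_schwartzMap_fourier_eq_invTransform (hh : IsTestAwayFromZero h) :
    ∃ γ : 𝓢(EuclideanSpace ℝ (Fin n), ℂ),
      (∀ x, (𝓕 γ : 𝓢(EuclideanSpace ℝ (Fin n), ℂ)) x = invTransform h x) ∧
        ∀ x, conj (γ x) = γ (-x) :=
  exists_fourier_eq_ofReal (contDiff_invTransform hh.1 hh.2.1 hh.2.2)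
    (hasCompactSupport_invTransform hh.2.2)

theorem isometry_formula (hn : Odd n) (hh : IsTestAwayFromZero h) :
    ∫ x : EuclideanSpace ℝ (Fin n), ‖x‖ ^ (2 * (n : ℤ) - 4) * |h x| ^ 2 =
      2 * Real.pi / Real.Gamma ((n : ℝ) / 2) ^ 2 * ∫ y : EuclideanSpace ℝ (Fin n),
        |meanData ((n - 1) / 2) h y| ^ 2 * ‖y‖ ^ (-(n : ℤ) - 1) := by
  obtain ⟨γ, hγ, hγ'⟩ := exists_schwartzMap_fourier_eq_invTransform hh
  obtain ⟨m, hm⟩ := hn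
  have : Nonempty (Fin n) := ⟨⟨0, by omega⟩⟩
  have hn' : (0 : ℝ) < n := by exact_mod_cast (by omega : 0 < n)
  have hΓ := (Real.Gamma_pos_of_pos (half_pos hn')).ne'
  have hω := sphereArea_sq (show n ≠ 0 by omega)
  have h1 := integral_invTransform_sq hh.1 hh.2.1 hh.2.2
  rw [finrank_euclideanSpace_fin] at h1
  have hpow : Real.pi ^ n = Real.pi ^ (2 * m) * Real.pi := by rw [hm, pow_succ]
  have hpi := Real.pi_ne_zero
  rw [show (n - 1) / 2 = m by omega, integral_meanData_sq hm hh hγ hγ', h1, inv_pow, hω, hpow]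
  field_simp
  ring

theorem inversion_formula (hn : Odd n) (hh : IsTestAwayFromZero h)
    {x : EuclideanSpace ℝ (Fin n)} (hx : x ≠ 0) :
    IntegrableOn (fun y => ‖y‖ ^ (-(n : ℤ)) * meanData (n - 1) h y) (bisector x) μHE[n - 1] ∧
      h x = (-1 : ℝ) ^ ((n - 1) / 2) * sphereArea n / (2 * Real.pi ^ (n - 1)) *
        ‖x‖ ^ (3 - 2 * (n : ℤ)) *
          ∫ y in bisector x, ‖y‖ ^ (-(n : ℤ)) * meanData (n - 1) h y ∂μHE[n - 1] := by
  obtain ⟨γ, hγ, hγ'⟩ := exists_schwartzMap_fourier_eq_invTransform hh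
  obtain ⟨m, hm⟩ := hn
  set e := ‖x‖⁻¹ • x with he'
  have hN : 0 < ‖x‖ := norm_pos_iff.2 hx
  have he : ‖e‖ = 1 := norm_smul_inv_norm hx
  have hr : 0 < ‖x‖ / 2 := half_pos hN
  have hxe : (2 * (‖x‖ / 2)) • e = x := by
    rw [he', smul_smul]
    convert one_smul ℝ x
    field_simp
  -- With `r = |x|/2` the frequency point `e/(2r)` is the inversion of `x`. The `r^n` here against
  -- the `r^(n-1)` of `integral_bisector` leaves one factor `|x|/2`, the source of the `2` in the
  -- denominator.
  obtain ⟨h1, h2⟩ := integral_meanData_cone hm hh hγ hγ' he hr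
  have hξ : (2 * (‖x‖ / 2))⁻¹ • e = (‖x‖ ^ 2)⁻¹ • x := by
    rw [he', smul_smul]
    congr 1
    field_simp
  have h3 := integrableOn_bisector he hr
    (Q := fun y ↦ ‖y‖ ^ (-(n : ℤ)) * meanData (n - 1) h y) h1
  have h4 := integral_bisector he hr (fun y ↦ ‖y‖ ^ (-(n : ℤ)) * meanData (n - 1) h y)
  rw [hxe] at h3 h4
  refine ⟨h3, ?_⟩
  rw [hξ, invTransform, inversion_inversion_zero, norm_inversion, finrank_euclideanSpace_fin] at h2
  set J := ∫ w : (ℝ ∙ e)ᗮ, ‖(‖x‖ / 2) • (e + w.1)‖ ^ (-(n : ℤ)) *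
    meanData (n - 1) h ((‖x‖ / 2) • (e + w.1))
  have hpow (t : ℝ) : t ^ n = t ^ (2 * m) * t := by rw [hm, pow_succ]
  have hz : ‖x‖ ^ (3 - 2 * (n : ℤ)) = ‖x‖ * ((‖x‖ ^ (2 * m)) ^ 2)⁻¹ := by
    rw [show 3 - 2 * (n : ℤ) = 1 - ((2 * m * 2 : ℕ) : ℤ) by rw [hm]; push_cast; ring,
      zpow_sub₀ hN.ne', zpow_one, zpow_natCast, pow_mul, div_eq_mul_inv]
  have h5 : (((‖x‖⁻¹) ^ 2)⁻¹) ^ (n - 1) = (‖x‖ ^ (2 * m)) ^ 2 := by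
    rw [show n - 1 = 2 * m by omega, inv_pow ‖x‖, inv_inv, pow_right_comm]
  rw [h5] at h2
  have h6 : h x = ((‖x‖ ^ (2 * m)) ^ 2)⁻¹ * ((‖x‖ / 2) ^ n * (-1) ^ m * sphereArea n /
      Real.pi ^ (n - 1) * J) := by
    rw [← h2]
    field_simp
  rw [h6, h4, hz, show (n - 1) / 2 = m by omega, show n - 1 = 2 * m by omega, hpow]
  have hpi := Real.pi_ne_zero
  field_simp

end Main

end OriginSpheres

end

open MeasureTheory OriginSpheres in
theorem theorem4 (n : ℕ) (hn : Odd n) (h : EuclideanSpace ℝ (Fin n) → ℝ)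
    (hh : IsTestAwayFromZero h) :
    -- the radial derivatives of the spherical mean data exist in the classical sense
    (∀ θ : EuclideanSpace ℝ (Fin n), ‖θ‖ = 1 →
      ContDiffOn ℝ (⊤ : ℕ∞) (fun ρ : ℝ => weightedOriginMean h (ρ • θ)) (Set.Ioi 0)) ∧
    -- the isometry, with convergent integrals
    (Integrable (fun x : EuclideanSpace ℝ (Fin n) =>
        ‖x‖ ^ (2 * (n : ℤ) - 4) * |h x| ^ 2) volume ∧
      Integrable (fun y : EuclideanSpace ℝ (Fin n) =>
        |meanData ((n - 1) / 2) h y| ^ 2 * ‖y‖ ^ (-(n : ℤ) - 1)) volume ∧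
      ∫ x : EuclideanSpace ℝ (Fin n), ‖x‖ ^ (2 * (n : ℤ) - 4) * |h x| ^ 2 =
        2 * Real.pi / Real.Gamma ((n : ℝ) / 2) ^ 2 *
          ∫ y : EuclideanSpace ℝ (Fin n),
            |meanData ((n - 1) / 2) h y| ^ 2 * ‖y‖ ^ (-(n : ℤ) - 1)) ∧
    -- the inversion formula, with a convergent integral
    (∀ x : EuclideanSpace ℝ (Fin n), x ≠ 0 →
      IntegrableOn (fun y => ‖y‖ ^ (-(n : ℤ)) * meanData (n - 1) h y) (bisector x) μHE[n - 1] ∧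
      h x = (-1 : ℝ) ^ ((n - 1) / 2) * sphereArea n / (2 * Real.pi ^ (n - 1)) *
        ‖x‖ ^ (3 - 2 * (n : ℤ)) *
          ∫ y in bisector x, ‖y‖ ^ (-(n : ℤ)) * meanData (n - 1) h y ∂μHE[n - 1]) ∧
    -- the means over the spheres through the origin determine the function
    (∀ h' : EuclideanSpace ℝ (Fin n) → ℝ, IsTestAwayFromZero h' →
      (∀ y, sphericalMean h' y ‖y‖ = sphericalMean h y ‖y‖) → h' = h) := by
  obtain ⟨γ, hγ, -⟩ := exists_schwartzMap_fourier_eq_invTransform hh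
  refine ⟨fun θ hθ ↦ contDiffOn_weightedOriginMean hh hγ hθ,
    ⟨integrable_zpow_norm_mul hh.1.continuous hh.2.1 hh.2.2 _,
      integrable_meanData_sq hn.pos hh hγ _, isometry_formula hn hh⟩,
    fun x hx ↦ inversion_formula hn hh hx, fun h' hh' heq ↦ ?_⟩
  have hmean (k : ℕ) : meanData k h' = meanData k h := by
    have : weightedOriginMean h' = weightedOriginMean h := by
      funext y
      rw [weightedOriginMean, heq, weightedOriginMean]
    rw [meanData, this, meanData]
  funext x
  -- The inversion formula excludes the origin, but there both functions vanish by the support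
  -- hypothesis.
  rcases eq_or_ne x 0 with rfl | hx
  · rw [image_eq_zero_of_notMem_tsupport hh.2.2, image_eq_zero_of_notMem_tsupport hh'.2.2]
  · rw [(inversion_formula hn hh hx).2, (inversion_formula hn hh' hx).2, hmean]
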